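/- **Setting.** Let $x=(x_1,\dots,x_g)$ and $h=(h_1,\dots,h_g)$ be noncommuting indeterminates. On real polynomials in these indeterminates let $^T$ denote the linear involution that reverses words and fixes each $x_j$ and each $h_j$; for a matrix $M=[M_{ij}]$ of such polynomials put $(M^T)_{ij}=M_{ji}^T$. Let $p=p(x)$ be a symmetric polynomial ($p=p^T$) of degree $d\ge 1$. Let $p'(x)[h]$ be the coefficient of $t$ in $p(x+th)-p(x)$, let $p''(x)[h]$ be the Hessian, obtained from $p'(x)[h]$ by differentiating once more in $x$ in the direction $h$ ($h$ held fixed), and for $\lambda\in\mathbb R$ let $$p''_\lambda(x)[h]=p''(x)[h]+\lambda\,p'(x)[h]^T\,p'(x)[h]$$ be the modified Hessian. Let $V_k=V_k(x)[h]$ be the column with the $g^{k+1}$ entries $h_jm(x)$, where $m$ runs through the words of length $k$ in $x$ and $1\le j\le g$, and let $V=\mathrm{col}(V_0,\dots,V_{d-2})$ (empty if $d=1$) and $\widetilde V=\mathrm{col}(V_0,\dots,V_{d-1})$. There are a unique matrix polynomial $Z(x)$ with $p''(x)[h]=V^TZ(x)V$ and a unique column $\psi=\mathrm{col}(\psi_0,\dots,\psi_{d-1})$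 of polynomials in $x$ with $p'(x)[h]=\sum_{s=0}^{d-1}\psi_s(x)^TV_s$. Put $\mathcal Z=Z(0)$, a real symmetric matrix, and $$Z_\lambda(x)=\begin{bmatrix}Z(x)&0\\0&0\end{bmatrix}+\lambda\,\psi(x)\psi(x)^T,\qquad \mathcal Z_\lambda=\begin{bmatrix}\mathcal Z&0\\0&\lambda\,\psi_{d-1}(0)\psi_{d-1}(0)^T\end{bmatrix}.$$ $Z_\lambda$ is the middle matrix of the modified Hessian: it is the unique matrix polynomial with $p''_\lambda(x)[h]=\widetilde V^TZ_\lambda(x)\widetilde V$. For a real symmetric matrix $A$ let $\mu_\pm(A)$ be the number of its positive (negative) eigenvalues, counted with multiplicity. For a symmetric polynomial $q(x)[h]$ that is homogeneous of degree two in $h$, let $\sigma_-^{\min}(q)$ be the smallest number $b$ of negative squares in a decomposition $q=\sum_{j=1}^{a}(f_j^+)^Tf_j^+-\sum_{l=1}^{b}(f_l^-)^Tf_l^-$ with polynomials $f_j^+,f_l^-$ in $(x,h)$ that are homogeneous of degree one in $h$. **Theorem.** Let $p$ be a symmetric polynomial of degree $d\ge1$ in $x_1,\dots,x_g$. Then $\psi_{d-1}(x)=\psi_{d-1}(0)$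 is a constant nonzero vector of size $g^d$, and there is a square matrix polynomial $S(x)$, independent of $\lambda$, whose inverse is again a matrix polynomial, such that $$Z_\lambda(x)=S(x)^T\,\mathcal Z_\lambda\,S(x)\qquad\text{for every }\lambda\in\mathbb R.$$ In particular, for every $g$-tuple $X$ of real symmetric $n\times n$ matrices, $S(X)$ is invertible and $Z_\lambda(X)=S(X)^T(\mathcal Z_\lambda\otimes I_n)S(X)$ for every $\lambda\in\mathbb R$. Consequently, for every $\lambda>0$: 1. $\mu_+(\mathcal Z_\lambda)=\mu_+(\mathcal Z)+1$ and $\mu_-(\mathcal Z_\lambda)=\mu_-(\mathcal Z)$; 2. $\mathcal Z_\lambda\succeq0$ if and only if $\mathcal Z\succeq0$; 3. if $\mathcal Z_\lambda\succeq0$, then $d\le2$; 4. $d\le 2\,\sigma_-^{\min}(p''_\lambda)+2$. -/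

import Mathlib

open scoped Matrix Kronecker

noncomputable section

namespace NCHess

/-- Polynomials in the noncommuting symmetric variables `x_1, …, x_g`. The involution is Mathlib's
`star` on the free algebra: it reverses words and fixes the variables and the real scalars. -/
abbrev NCPoly (g : ℕ) : Type := FreeAlgebra ℝ (Fin g)

/-- Polynomials in the `2 g` noncommuting symmetric variables `x_1, …, x_g, h_1, …, h_g`. -/
abbrev NCPolyXH (g : ℕ) : Type := FreeAlgebra ℝ (Fin g ⊕ Fin g)

variable {g : ℕ}

/-- The variable `x_j` of `NCPolyXH g`. -/
def xvar (j : Fin g) : NCPolyXH g := FreeAlgebra.ι ℝ (Sum.inl j)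

/-- The variable `h_j` of `NCPolyXH g`. -/
def hvar (j : Fin g) : NCPolyXH g := FreeAlgebra.ι ℝ (Sum.inr j)

/-- A polynomial in `x` regarded as a polynomial in `x` and `h`. -/
def inX : NCPoly g →ₐ[ℝ] NCPolyXH g := FreeAlgebra.lift ℝ xvar

/-- The degree of `p`: the maximal length of the words that occur in `p` with a nonzero
coefficient (with the value `0` for `p = 0`). -/
def ncDegree (p : NCPoly g) : ℕ :=
  (FreeAlgebra.equivMonoidAlgebraFreeMonoid p).coeff.support.sup FreeMonoid.length

/-- The substitution `x_j ↦ x_j + ε h_j`, `h_j ↦ h_j` with `ε ^ 2 = 0`. -/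
def shiftX : NCPolyXH g →ₐ[ℝ] DualNumber (NCPolyXH g) :=
  FreeAlgebra.lift ℝ (Sum.elim (fun j => TrivSqZeroExt.inl (xvar j) + TrivSqZeroExt.inr (hvar j))
    (fun j => TrivSqZeroExt.inl (hvar j)))

/-- The formal directional derivative in `x` in the direction `h` (with `h` held fixed): the
coefficient of `t` in `q(x + t h)[h] - q(x)[h]`. -/
def dirDeriv (q : NCPolyXH g) : NCPolyXH g := (shiftX q).snd

/-- `p'(x)[h]`. -/
def firstDeriv (p : NCPoly g) : NCPolyXH g := dirDeriv (inX p)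

/-- The Hessian `p''(x)[h]`. -/
def hessian (p : NCPoly g) : NCPolyXH g := dirDeriv (firstDeriv p)

/-- The modified Hessian `p''(x)[h] + λ p'(x)[h]ᵀ p'(x)[h]`. -/
def modifiedHessian (p : NCPoly g) (lam : ℝ) : NCPolyXH g :=
  hessian p + lam • (star (firstDeriv p) * firstDeriv p)

/-- Indices of the entries `h_j m(x)` of `V_k(x)[h]`: pairs of a word `m` of length `k` and a
`j`. There are `g ^ (k + 1)` of them. -/
abbrev BlockIdx (g k : ℕ) : Type := (Fin k → Fin g) × Fin g

/-- The entry `h_j m(x)` of the border vector. -/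
def borderEntry {k : ℕ} (i : BlockIdx g k) : NCPolyXH g :=
  hvar i.2 * (List.ofFn fun a => xvar (i.1 a)).prod

/-- Indices of the border vector `V = col(V_0, …, V_{d-2})` (empty for `d = 1`). -/
abbrev LowIdx (g d : ℕ) : Type := Σ k : Fin (d - 1), BlockIdx g k

/-- Indices of the last block `V_{d-1}` of the extended border vector. -/
abbrev TopIdx (g d : ℕ) : Type := BlockIdx g (d - 1)

/-- Indices of the extended border vector `col(V_0, …, V_{d-1})`, split as
`col(V_0, …, V_{d-2})` followed by `V_{d-1}`. -/
abbrev FullIdx (g d : ℕ) : Type := LowIdx g d ⊕ TopIdx g d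

/-- The border vector `V(x)[h] = col(V_0, …, V_{d-2})`. -/
def border (g d : ℕ) (i : LowIdx g d) : NCPolyXH g := borderEntry i.2

/-- The extended border vector `col(V_0, …, V_{d-1})`. -/
def borderExt (g d : ℕ) : FullIdx g d → NCPolyXH g :=
  Sum.elim (border g d) borderEntry

/-- `q(x)[h] = v(x)[h]ᵀ M(x) v(x)[h]`, i.e. the matrix polynomial `M` is the middle matrix of `q`
relative to the border vector `v`. -/
def IsMiddleMatrix {I : Type} [Fintype I] (v : I → NCPolyXH g) (q : NCPolyXH g)
    (M : Matrix I I (NCPoly g)) : Prop :=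
  q = ∑ i, ∑ j, star (v i) * inX (M i j) * v j

/-- `q(x)[h] = ψ(x)ᵀ v(x)[h]` for the column `ψ` of polynomials in `x`. -/
def IsCoeffVector {I : Type} [Fintype I] (v : I → NCPolyXH g) (q : NCPolyXH g)
    (ψ : I → NCPoly g) : Prop :=
  q = ∑ i, inX (star (ψ i)) * v i

/-- The value `p(0)` at `0 ∈ ℝ^g`. -/
def atZero : NCPoly g →ₐ[ℝ] ℝ := FreeAlgebra.lift ℝ fun _ => 0

/-- The scalar middle matrix `Z(0)`. -/
def scalarMiddle {I : Type} (Z : Matrix I I (NCPoly g)) : Matrix I I ℝ := Z.map atZero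

/-- The vector `ψ_{d-1}(0)`, of size `g ^ d`. -/
def topVec {d : ℕ} (ψ : FullIdx g d → NCPoly g) : TopIdx g d → ℝ := fun i => atZero (ψ (Sum.inr i))

/-- The middle matrix `[Z 0; 0 0] + λ ψ ψᵀ` of the modified Hessian. -/
def modMiddle {d : ℕ} (Z : Matrix (LowIdx g d) (LowIdx g d) (NCPoly g))
    (ψ : FullIdx g d → NCPoly g) (lam : ℝ) : Matrix (FullIdx g d) (FullIdx g d) (NCPoly g) :=
  Matrix.fromBlocks Z 0 0 0 + lam • Matrix.of fun i j => ψ i * star (ψ j)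

/-- The scalar middle matrix `diag(Z(0), λ ψ_{d-1}(0) ψ_{d-1}(0)ᵀ)` of the modified Hessian. -/
def scalarModMiddle {d : ℕ} (Z : Matrix (LowIdx g d) (LowIdx g d) (NCPoly g))
    (ψ : FullIdx g d → NCPoly g) (lam : ℝ) : Matrix (FullIdx g d) (FullIdx g d) ℝ :=
  Matrix.fromBlocks (scalarMiddle Z) 0 0 (lam • Matrix.vecMulVec (topVec ψ) (topVec ψ))

/-- The constant matrix polynomial with value `A`. -/
def constMatrix {I : Type} (A : Matrix I I ℝ) : Matrix I I (NCPoly g) :=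
  A.map (algebraMap ℝ (NCPoly g))

/-- The value `M(X)` of a matrix polynomial at a tuple of `n × n` matrices, a block matrix with
`n × n` blocks. -/
def evalMatrix {I : Type} {n : ℕ} (X : Fin g → Matrix (Fin n) (Fin n) ℝ)
    (M : Matrix I I (NCPoly g)) : Matrix (I × Fin n) (I × Fin n) ℝ :=
  Matrix.of fun a b => FreeAlgebra.lift ℝ X (M a.1 b.1) a.2 b.2

/-- `μ₊(A)`: the number of positive eigenvalues of the real symmetric matrix `A`, counted with
multiplicity. -/
def muPos {I : Type} [Fintype I] [DecidableEq I] (A : Matrix I I ℝ) : ℕ :=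
  (A.charpoly.roots.filter fun t => 0 < t).card

/-- `μ₋(A)`: the number of negative eigenvalues of the real symmetric matrix `A`, counted with
multiplicity. -/
def muNeg {I : Type} [Fintype I] [DecidableEq I] (A : Matrix I I ℝ) : ℕ :=
  (A.charpoly.roots.filter fun t => t < 0).card

/-- The polynomials in `(x, h)` that are homogeneous of degree one in `h`. -/
def linearInH (g : ℕ) : Submodule ℝ (NCPolyXH g) :=
  Submodule.span ℝ {f | ∃ (u v : NCPoly g) (j : Fin g), f = inX u * hvar j * inX v}

/-- `q = ∑ f⁺ᵀ f⁺ - ∑ f⁻ᵀ f⁻` with `a` positive and `b` negative squares of polynomials that are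
homogeneous of degree one in `h`. -/
def HasSDS (q : NCPolyXH g) (a b : ℕ) : Prop :=
  ∃ (fp : Fin a → NCPolyXH g) (fm : Fin b → NCPolyXH g),
    (∀ j, fp j ∈ linearInH g) ∧ (∀ l, fm l ∈ linearInH g) ∧
      q = ∑ j, star (fp j) * fp j - ∑ l, star (fm l) * fm l

/-- `σ₋^min(q)`: the smallest number of negative squares in a decomposition of `q`, for `q`
homogeneous of degree two in `h`. -/
def sigmaNegMin (q : NCPolyXH g) : ℕ := sInf {b | ∃ a, HasSDS q a b}

end NCHess

end

/-! Index the border entry `h_j m` by the word `j m`, and let `c_w` be the coefficient of `w` in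
`p`. Stripping suffixes from `p` gives `ψ_b = (∑_u c_{ub} u)ᵀ` and `Z_{a,b} = 2 ∑_w c_{aᵀwb} w`, so
both are explicit. They are unique because `h` occurs exactly once in a border entry, as its first
letter.

Congruence. Splitting off the last letter of `w` turns the formula for `Z` into `Z = 𝒵 + Z N`, where
`N` has the entry `x_k` at `(kb, b)`. The matrix `N` lengthens words, hence is nilpotent, and `Z (1
- N) = 𝒵` (`midMatrix_mul_one_sub_shiftMatrix`). Since `Z` and `𝒵` are self-adjoint, `Z N = Nᵀ Z`.
For a polynomial `f` with `f² = 1 - X` modulo a high power of `X`, therefore, `f(N)ᵀ Z f(N) = Z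
f(N)² = 𝒵`, and `f(N)⁻¹` is the congruence (`exists_isUnit_star_mul_mul`). The block `ψ_{d-1}` is a
nonzero constant, so a block-triangular factor that does not involve `λ` clears the rest of `λ ψ ψᵀ`
(`exists_congruence_modMiddle`).

Inertia. The added diagonal block is `λ` times a nonzero rank one square, which contributes one
positive eigenvalue and zeros.

Degree bound. Cut a word of length `d` with nonzero coefficient at places beyond its middle. The
reversed prefixes span an isotropic space for `𝒵`, because pairing two of them would need words
longer than `d`. They pair triangularly with the complementary suffixes, which forces about `d/2`
negative squares (`le_card_negative_squares`). A decomposition of `p''_λ` yields one of `Z_λ(0)`.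
Elimination with a nonzero entry of `ψ_{d-1}` as pivot turns it into one of `𝒵` with no more
negative squares (`HasSDS.exists_scalarMiddle_eq`). -/

noncomputable section

namespace NCHess

/-! ### Words, coefficients and removal of suffixes -/

section Words

variable {X : Type}

/-- The monomial of a word. -/
def word (w : List X) : FreeAlgebra ℝ X := (w.map (FreeAlgebra.ι ℝ)).prod

@[simp] theorem word_nil : word ([] : List X) = 1 := rfl

theorem word_cons (x : X) (w : List X) : word (x :: w) = FreeAlgebra.ι ℝ x * word w := rfl

theorem word_append (u v : List X) : word (u ++ v) = word u * word v := by
  simp [word]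

@[simp] theorem word_singleton (x : X) : word [x] = FreeAlgebra.ι ℝ x := by simp [word]

theorem star_word (w : List X) : star (word w) = word w.reverse := by
  induction w with
  | nil => simp
  | cons x w ih => simp [word_cons, word_append, ih]

theorem equivMonoidAlgebraFreeMonoid_word (w : List X) :
    FreeAlgebra.equivMonoidAlgebraFreeMonoid (word w) =
      MonoidAlgebra.single (FreeMonoid.ofList w) (1 : ℝ) := by
  induction w with
  | nil => simp; rfl
  | cons x w ih =>
    rw [word_cons, map_mul, ih]
    simp [FreeAlgebra.equivMonoidAlgebraFreeMonoid, MonoidAlgebra.of_apply,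
      MonoidAlgebra.single_mul_single]

/-- The basis of words of the free algebra. -/
def wordBasis (X : Type) : Module.Basis (List X) ℝ (FreeAlgebra ℝ X) :=
  FreeAlgebra.basisFreeMonoid ℝ X

theorem wordBasis_apply (w : List X) : wordBasis X w = word w := by
  apply FreeAlgebra.equivMonoidAlgebraFreeMonoid.injective
  rw [equivMonoidAlgebraFreeMonoid_word]
  change FreeAlgebra.equivMonoidAlgebraFreeMonoid
    (FreeAlgebra.equivMonoidAlgebraFreeMonoid.symm _) = _
  rw [AlgEquiv.apply_symm_apply]
  rfl

theorem wordBasis_repr (p : FreeAlgebra ℝ X) (w : List X) :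
    (wordBasis X).repr p w =
      (FreeAlgebra.equivMonoidAlgebraFreeMonoid p).coeff (FreeMonoid.ofList w) := rfl

theorem span_word : Submodule.span ℝ (Set.range (word (X := X))) = ⊤ := by
  rw [← (wordBasis X).span_eq]
  congr 2
  exact funext fun w => (wordBasis_apply w).symm

theorem word_induction {P : FreeAlgebra ℝ X → Prop} (p : FreeAlgebra ℝ X)
    (hw : ∀ w, P (word w)) (hadd : ∀ a b, P a → P b → P (a + b))
    (hsmul : ∀ (r : ℝ) a, P a → P (r • a)) : P p := by
  have hp : p ∈ Submodule.span ℝ (Set.range (word (X := X))) := by simp [span_word]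
  induction hp using Submodule.span_induction with
  | mem x hx => obtain ⟨w, rfl⟩ := hx; exact hw w
  | zero => simpa using hsmul 0 _ (hw [])
  | add a b _ _ ha hb => exact hadd _ _ ha hb
  | smul r a _ ha => exact hsmul r a ha

theorem star_smul_real (r : ℝ) (p : FreeAlgebra ℝ X) : star (r • p) = r • star p := by
  rw [Algebra.smul_def, star_mul, FreeAlgebra.star_algebraMap, Algebra.smul_def, Algebra.commutes]

/-- The constant term. -/
def constTerm : FreeAlgebra ℝ X →ₐ[ℝ] ℝ := FreeAlgebra.lift ℝ fun _ => 0

@[simp] theorem constTerm_ι (x : X) : constTerm (FreeAlgebra.ι ℝ x) = 0 := by simp [constTerm]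

theorem constTerm_word (w : List X) : constTerm (word w) = if w = [] then 1 else 0 := by
  cases w with
  | nil => simp
  | cons x w => simp [word_cons]

@[simp] theorem constTerm_star (p : FreeAlgebra ℝ X) : constTerm (star p) = constTerm p := by
  induction p using word_induction with
  | hw w => simp [star_word, constTerm_word]
  | hadd a b ha hb => simp [ha, hb]
  | hsmul r a ha => simp [star_smul_real, ha]

variable [DecidableEq X]

/-- Removes the last letter `k` from the words ending in `k` and kills all other words. -/
def rstrip (k : X) : FreeAlgebra ℝ X →ₗ[ℝ] FreeAlgebra ℝ X :=
  (wordBasis X).constr ℝ fun w => if w.getLast? = some k then word w.dropLast else 0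

theorem rstrip_word (k : X) (w : List X) :
    rstrip k (word w) = if w.getLast? = some k then word w.dropLast else 0 := by
  rw [rstrip, ← wordBasis_apply, Module.Basis.constr_basis]

@[simp] theorem rstrip_one (k : X) : rstrip k (1 : FreeAlgebra ℝ X) = 0 := by
  simpa using rstrip_word k []

theorem rstrip_mul_ι (k l : X) (p : FreeAlgebra ℝ X) :
    rstrip k (p * FreeAlgebra.ι ℝ l) = if l = k then p else 0 := by
  induction p using word_induction with
  | hw w =>
    rw [← word_singleton, ← word_append, rstrip_word]
    simp
  | hadd a b ha hb => rw [add_mul, map_add, ha, hb]; split_ifs <;> simp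
  | hsmul r a ha => rw [smul_mul_assoc, map_smul, ha]; split_ifs <;> simp

@[simp] theorem rstrip_ι (k l : X) :
    rstrip k (FreeAlgebra.ι ℝ l : FreeAlgebra ℝ X) = if l = k then 1 else 0 := by
  simpa using rstrip_mul_ι k l 1

theorem eq_constTerm_add_sum_rstrip [Fintype X] (p : FreeAlgebra ℝ X) :
    p = algebraMap ℝ _ (constTerm p) + ∑ k, rstrip k p * FreeAlgebra.ι ℝ k := by
  induction p using word_induction with
  | hw w =>
    rcases List.eq_nil_or_concat w with rfl | ⟨u, x, rfl⟩
    · simp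
    · simp [word_append, rstrip_mul_ι]
  | hadd a b ha hb =>
    simp only [map_add, add_mul, Finset.sum_add_distrib]
    nth_rw 1 [ha, hb]; abel
  | hsmul r a ha =>
    nth_rw 1 [ha]
    simp only [map_smul, smul_add, Finset.smul_sum, smul_mul_assoc, smul_eq_mul, map_mul,
      Algebra.smul_def (R := ℝ) r (algebraMap ℝ (FreeAlgebra ℝ X) _)]

/-- Removes the suffix `b`. -/
def rstrips : List X → FreeAlgebra ℝ X →ₗ[ℝ] FreeAlgebra ℝ X
  | [] => LinearMap.id
  | k :: b => rstrip k ∘ₗ rstrips b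

@[simp] theorem rstrips_nil (p : FreeAlgebra ℝ X) : rstrips [] p = p := rfl

theorem rstrips_cons (k : X) (b : List X) (p : FreeAlgebra ℝ X) :
    rstrips (k :: b) p = rstrip k (rstrips b p) := rfl

theorem rstrips_append (a b : List X) (p : FreeAlgebra ℝ X) :
    rstrips (a ++ b) p = rstrips a (rstrips b p) := by
  induction a with
  | nil => rfl
  | cons k a ih => rw [List.cons_append, rstrips_cons, rstrips_cons, ih]

/-- Conjugation by `star` turns removal of the last letter into removal of the first, and removals
at opposite ends commute. A one-letter word is killed on both sides, since nothing remains for the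
second removal. -/
theorem rstrip_star_rstrip_star (k l : X) (p : FreeAlgebra ℝ X) :
    rstrip k (star (rstrip l (star p))) = star (rstrip l (star (rstrip k p))) := by
  induction p using word_induction with
  | hw w =>
    rcases w with _ | ⟨x, w⟩
    · simp
    · rcases List.eq_nil_or_concat w with rfl | ⟨u, y, rfl⟩
      · simp only [word_singleton, FreeAlgebra.star_ι, rstrip_ι]
        split_ifs <;> simp
      · have h1 : word (x :: u.concat y) = FreeAlgebra.ι ℝ x * word u * FreeAlgebra.ι ℝ y := by
          simp [word_cons, word_append, mul_assoc]
        have h2 : star (word (x :: u.concat y)) =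
            FreeAlgebra.ι ℝ y * star (word u) * FreeAlgebra.ι ℝ x := by
          rw [h1]; simp [mul_assoc]
        rw [h2, h1, rstrip_mul_ι, rstrip_mul_ι]
        split_ifs <;> simp [rstrip_mul_ι, *]
  | hadd a b ha hb => simp [ha, hb]
  | hsmul r a ha => simp [star_smul_real, ha]

theorem rstrip_star_rstrips_star (k : X) (b : List X) (p : FreeAlgebra ℝ X) :
    rstrip k (star (rstrips b (star p))) = star (rstrips b (star (rstrip k p))) := by
  induction b with
  | nil => simp
  | cons l b ih =>
    have := rstrip_star_rstrip_star k l (star (rstrips b (star p)))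
    rw [star_star] at this
    rw [rstrips_cons, this, ih, star_star, rstrips_cons]

theorem rstrips_star_rstrips_star (a b : List X) (p : FreeAlgebra ℝ X) :
    rstrips a (star (rstrips b (star p))) = star (rstrips b (star (rstrips a p))) := by
  induction a with
  | nil => simp
  | cons k a ih => rw [rstrips_cons, ih, rstrip_star_rstrips_star, rstrips_cons]

/-- The coefficient of a word. -/
def wcoeff (b : List X) (p : FreeAlgebra ℝ X) : ℝ := constTerm (rstrips b p)

theorem rstrips_word (b w : List X) :
    rstrips b (word w) = if b <:+ w then word (w.take (w.length - b.length)) else 0 := by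
  induction b generalizing w with
  | nil => simp
  | cons k b ih =>
    rw [rstrips_cons, ih]
    by_cases h : b <:+ w
    · obtain ⟨u, rfl⟩ := h
      have h2 : k :: b <:+ u ++ b ↔ u.getLast? = some k := by
        constructor
        · rintro ⟨v, hv⟩
          have : v ++ [k] = u := by
            rw [List.append_cons] at hv
            exact List.append_cancel_right hv
          simp [← this]
        · intro h
          obtain ⟨v, rfl⟩ := List.getLast?_eq_some_iff.1 h
          exact ⟨v, by simp⟩
      simp only [List.suffix_append, if_true, h2]
      simp only [List.length_append, Nat.add_sub_cancel, List.take_left', rstrip_word]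
      split_ifs with h3
      · congr 1
        obtain ⟨v, rfl⟩ := List.getLast?_eq_some_iff.1 h3
        have : v.length + 1 + b.length - (b.length + 1) = v.length := by omega
        simp [this]
      · rfl
    · have h2 : ¬ k :: b <:+ w := fun h' => h ((List.suffix_cons k b).trans h')
      simp [h, h2]

theorem wcoeff_word (b w : List X) : wcoeff b (word w) = if b = w then 1 else 0 := by
  rw [wcoeff, rstrips_word]
  by_cases h : b <:+ w
  · obtain ⟨u, rfl⟩ := h
    simp [constTerm_word]
  · have : b ≠ w := by rintro rfl; simp at h
    simp [h, this]

theorem wcoeff_add (b : List X) (p q : FreeAlgebra ℝ X) :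
    wcoeff b (p + q) = wcoeff b p + wcoeff b q := by simp [wcoeff]

theorem wcoeff_smul (b : List X) (r : ℝ) (p : FreeAlgebra ℝ X) :
    wcoeff b (r • p) = r * wcoeff b p := by simp [wcoeff]

theorem wcoeff_eq_repr (b : List X) (p : FreeAlgebra ℝ X) :
    wcoeff b p = (wordBasis X).repr p b := by
  induction p using word_induction with
  | hw w =>
    rw [wcoeff_word, ← wordBasis_apply, Module.Basis.repr_self, Finsupp.single_apply]
    simp [eq_comm]
  | hadd a b ha hb => simp [wcoeff_add, ha, hb]
  | hsmul r a ha => simp [wcoeff_smul, ha]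

theorem eq_zero_of_wcoeff {p : FreeAlgebra ℝ X} (h : ∀ b, wcoeff b p = 0) : p = 0 := by
  apply (wordBasis X).repr.injective
  ext b
  rw [← wcoeff_eq_repr, h]; simp

theorem wcoeff_rstrips (a b : List X) (p : FreeAlgebra ℝ X) :
    wcoeff a (rstrips b p) = wcoeff (a ++ b) p := by
  rw [wcoeff, wcoeff, rstrips_append]

theorem wcoeff_star (b : List X) (p : FreeAlgebra ℝ X) :
    wcoeff b (star p) = wcoeff b.reverse p := by
  induction p using word_induction with
  | hw w => 
    rw [star_word, wcoeff_word, wcoeff_word]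
    congr 1
    rw [List.reverse_eq_iff]
  | hadd a b ha hb => simp [wcoeff_add, ha, hb]
  | hsmul r a ha => simp [wcoeff_smul, star_smul_real, ha]

theorem rstrips_eq_zero {n : ℕ} {p : FreeAlgebra ℝ X}
    (h : ∀ b : List X, n < b.length → wcoeff b p = 0) {b : List X} (hb : n < b.length) :
    rstrips b p = 0 :=
  eq_zero_of_wcoeff fun a => by
    rw [wcoeff_rstrips]; exact h _ (by simp; omega)

end Words

variable {g : ℕ}

theorem wcoeff_eq_zero_of_ncDegree_lt {p : NCPoly g} {b : List (Fin g)}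
    (hb : ncDegree p < b.length) : wcoeff b p = 0 := by
  rw [wcoeff_eq_repr, wordBasis_repr]
  by_contra h
  have := Finset.le_sup (f := FreeMonoid.length) (Finsupp.mem_support_iff.2 h)
  exact absurd (hb.trans_le this) (lt_irrefl _)

theorem exists_wcoeff_ne_zero {p : NCPoly g} (hd : 1 ≤ ncDegree p) :
    ∃ b : List (Fin g), b.length = ncDegree p ∧ wcoeff b p ≠ 0 := by
  have hne : (FreeAlgebra.equivMonoidAlgebraFreeMonoid p).coeff.support.Nonempty := by
    rw [Finset.nonempty_iff_ne_empty]
    intro h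
    simp [ncDegree, h] at hd
  obtain ⟨b, hb, hb'⟩ := Finset.exists_mem_eq_sup _ hne FreeMonoid.length
  refine ⟨b.toList, hb'.symm, ?_⟩
  rw [wcoeff_eq_repr, wordBasis_repr]
  exact Finsupp.mem_support_iff.1 hb

/-! ### First derivative and Hessian expanded along suffixes -/

section Derivative

theorem inX_word (w : List (Fin g)) : inX (word w) = word (w.map Sum.inl) := by
  induction w with
  | nil => simp
  | cons x w ih => rw [List.map_cons, word_cons, word_cons, map_mul, ih]; simp [inX, xvar]

theorem inX_star (p : NCPoly g) : inX (star p) = star (inX p) := by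
  induction p using word_induction with
  | hw w => simp [star_word, inX_word]
  | hadd a b ha hb => simp [ha, hb]
  | hsmul r a ha => simp [star_smul_real, ha]

theorem inX_injective : Function.Injective (inX (g := g)) := by
  let φ : NCPolyXH g →ₐ[ℝ] NCPoly g := FreeAlgebra.lift ℝ (Sum.elim (FreeAlgebra.ι ℝ) 0)
  have h : φ.comp inX = AlgHom.id ℝ _ := by ext j; simp [φ, inX, xvar]
  exact Function.LeftInverse.injective (g := φ) fun p => DFunLike.congr_fun h p

theorem shiftX_fst (q : NCPolyXH g) : (shiftX q).fst = q := by
  have h : (TrivSqZeroExt.fstHom ℝ (NCPolyXH g) (NCPolyXH g)).comp shiftX = AlgHom.id ℝ _ := by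
    ext j; rcases j with j | j <;> simp [shiftX, xvar, hvar]
  exact DFunLike.congr_fun h q

/-- The directional derivative as a linear map. -/
def dirDerivLinear : NCPolyXH g →ₗ[ℝ] NCPolyXH g :=
  TrivSqZeroExt.sndHom (NCPolyXH g) (NCPolyXH g) |>.restrictScalars ℝ |>.comp shiftX.toLinearMap

theorem dirDeriv_eq (q : NCPolyXH g) : dirDeriv q = dirDerivLinear q := rfl

theorem dirDeriv_add (p q : NCPolyXH g) : dirDeriv (p + q) = dirDeriv p + dirDeriv q := by
  simp [dirDeriv_eq]

theorem dirDeriv_sum {I : Type*} (s : Finset I) (f : I → NCPolyXH g) :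
    dirDeriv (∑ i ∈ s, f i) = ∑ i ∈ s, dirDeriv (f i) := by
  simp [dirDeriv_eq]

theorem dirDeriv_mul (p q : NCPolyXH g) :
    dirDeriv (p * q) = dirDeriv p * q + p * dirDeriv q := by
  simp [dirDeriv, shiftX_fst, add_comm]

@[simp] theorem dirDeriv_algebraMap (r : ℝ) :
    dirDeriv (algebraMap ℝ (NCPolyXH g) r) = 0 := by
  rw [dirDeriv, AlgHom.commutes]; rfl

@[simp] theorem dirDeriv_inl (j : Fin g) :
    dirDeriv (FreeAlgebra.ι ℝ (Sum.inl j) : NCPolyXH g) = FreeAlgebra.ι ℝ (Sum.inr j) := by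
  simp [dirDeriv, shiftX, xvar, hvar]

@[simp] theorem dirDeriv_inr (j : Fin g) :
    dirDeriv (FreeAlgebra.ι ℝ (Sum.inr j) : NCPolyXH g) = 0 := by
  simp [dirDeriv, shiftX, hvar]

theorem dirDeriv_star (q : NCPolyXH g) : dirDeriv (star q) = star (dirDeriv q) := by
  induction q using FreeAlgebra.induction with
  | grade0 r => simp
  | grade1 x => rcases x with j | j <;> simp
  | mul a b ha hb => simp [dirDeriv_mul, ha, hb, add_comm]
  | add a b ha hb => simp [dirDeriv_add, ha, hb]

theorem firstDeriv_star (p : NCPoly g) : firstDeriv (star p) = star (firstDeriv p) := by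
  rw [firstDeriv, inX_star, dirDeriv_star, firstDeriv]

theorem hessian_star (p : NCPoly g) : hessian (star p) = star (hessian p) := by
  rw [hessian, firstDeriv_star, dirDeriv_star, hessian]

theorem inX_eq_sum (p : NCPoly g) :
    inX p = algebraMap ℝ _ (constTerm p) +
      ∑ k, inX (rstrip k p) * FreeAlgebra.ι ℝ (Sum.inl k) := by
  conv_lhs => rw [eq_constTerm_add_sum_rstrip p]
  simp [inX, xvar]

theorem firstDeriv_eq_sum_rstrip (p : NCPoly g) :
    firstDeriv p = ∑ k, (inX (rstrip k p) * FreeAlgebra.ι ℝ (Sum.inr k) +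
      firstDeriv (rstrip k p) * FreeAlgebra.ι ℝ (Sum.inl k)) := by
  rw [firstDeriv, inX_eq_sum, dirDeriv_add, dirDeriv_sum]
  simp [dirDeriv_mul, firstDeriv, add_comm]

/-- With `p_k = rstrip k p`, the term `p_k' h_k` arises twice: from differentiating `p_k` in `p_k
h_k`, and from differentiating `x_k` in `p_k' x_k`. Hence the factor `2`. -/
theorem hessian_eq_sum_rstrip (p : NCPoly g) :
    hessian p = ∑ k, ((2 : ℝ) • (firstDeriv (rstrip k p) * FreeAlgebra.ι ℝ (Sum.inr k)) +
      hessian (rstrip k p) * FreeAlgebra.ι ℝ (Sum.inl k)) := by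
  rw [hessian, firstDeriv_eq_sum_rstrip, dirDeriv_sum]
  refine Finset.sum_congr rfl fun k _ => ?_
  rw [dirDeriv_add, dirDeriv_mul, dirDeriv_mul]
  simp [hessian, two_smul, ← firstDeriv.eq_1]
  abel

/-- The word `h_j m` in `x` and `h` attached to the word `j m`. -/
def hword : List (Fin g) → List (Fin g ⊕ Fin g)
  | [] => []
  | j :: m => Sum.inr j :: m.map Sum.inl

theorem hword_append {b : List (Fin g)} (hb : b ≠ []) (k : Fin g) :
    hword (b ++ [k]) = hword b ++ [Sum.inl k] := by
  cases b with
  | nil => exact absurd rfl hb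
  | cons j m => simp [hword]

theorem sum_ofFn_succ {M : Type*} [AddCommMonoid M] (n : ℕ) (F : List (Fin g) → M) :
    ∑ f : Fin (n + 1) → Fin g, F (List.ofFn f) =
      ∑ k, ∑ f : Fin n → Fin g, F (List.ofFn f ++ [k]) := by
  rw [← (Fin.snocEquiv fun _ => Fin g).sum_comp, Fintype.sum_prod_type]
  refine Finset.sum_congr rfl fun k _ => Finset.sum_congr rfl fun f _ => ?_
  rw [List.ofFn_succ', List.concat_eq_append]
  simp [Fin.snocEquiv]

theorem ofFn_succ_ne_nil {n : ℕ} (f : Fin (n + 1) → Fin g) : List.ofFn f ≠ [] := by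
  simp

theorem rstrip_coeff_eq_zero {n : ℕ} {p : NCPoly g}
    (h : ∀ b : List (Fin g), n + 1 < b.length → wcoeff b p = 0) (k : Fin g)
    (b : List (Fin g)) (hb : n < b.length) : wcoeff b (rstrip k p) = 0 := by
  have := wcoeff_rstrips b [k] p
  rw [rstrips_cons, rstrips_nil] at this
  rw [this]; exact h _ (by simpa using hb)

/-- Differentiation replaces one letter `x_j` by `h_j`. Grouping by that letter and the word `m`
behind it leaves in front what remains of `p` once the suffix `j m` is removed. -/
theorem firstDeriv_eq_sum {n : ℕ} {p : NCPoly g}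
    (h : ∀ b : List (Fin g), n < b.length → wcoeff b p = 0) :
    firstDeriv p = ∑ m ∈ Finset.range n, ∑ f : Fin (m + 1) → Fin g,
      inX (rstrips (List.ofFn f) p) * word (hword (List.ofFn f)) := by
  induction n generalizing p with
  | zero =>
    rw [firstDeriv_eq_sum_rstrip]
    refine Finset.sum_eq_zero fun k _ => ?_
    have : rstrip k p = 0 := rstrips_eq_zero h (b := [k]) (by simp)
    simp [this, firstDeriv, dirDeriv_eq]
  | succ n ih =>
    rw [firstDeriv_eq_sum_rstrip, Finset.sum_range_succ', add_comm, Finset.sum_add_distrib]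
    congr 1
    · rw [sum_ofFn_succ _ fun b => inX (rstrips b p) * word (hword b)]
      simp [rstrips_cons, hword]
    · simp_rw [ih (rstrip_coeff_eq_zero h _), Finset.sum_mul]
      rw [Finset.sum_comm]
      refine Finset.sum_congr rfl fun m _ => ?_
      rw [sum_ofFn_succ _ fun b => inX (rstrips b p) * word (hword b)]
      refine Finset.sum_congr rfl fun k _ => Finset.sum_congr rfl fun f _ => ?_
      rw [hword_append (ofFn_succ_ne_nil f), word_append, rstrips_append, mul_assoc,
        word_singleton]
      rfl

theorem hessian_eq_sum {n : ℕ} {p : NCPoly g}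
    (h : ∀ b : List (Fin g), n < b.length → wcoeff b p = 0) :
    hessian p = ∑ m ∈ Finset.range n, ∑ f : Fin (m + 1) → Fin g,
      (2 : ℝ) • (firstDeriv (rstrips (List.ofFn f) p) * word (hword (List.ofFn f))) := by
  induction n generalizing p with
  | zero =>
    rw [hessian_eq_sum_rstrip]
    refine Finset.sum_eq_zero fun k _ => ?_
    have : rstrip k p = 0 := rstrips_eq_zero h (b := [k]) (by simp)
    simp [this, hessian, firstDeriv, dirDeriv_eq]
  | succ n ih =>
    rw [hessian_eq_sum_rstrip, Finset.sum_range_succ', add_comm, Finset.sum_add_distrib]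
    congr 1
    · rw [sum_ofFn_succ _ fun b => (2 : ℝ) • (firstDeriv (rstrips b p) * word (hword b))]
      simp [rstrips_cons, hword]
    · simp_rw [ih (rstrip_coeff_eq_zero h _), Finset.sum_mul]
      rw [Finset.sum_comm]
      refine Finset.sum_congr rfl fun m _ => ?_
      rw [sum_ofFn_succ _ fun b => (2 : ℝ) • (firstDeriv (rstrips b p) * word (hword b))]
      refine Finset.sum_congr rfl fun k _ => Finset.sum_congr rfl fun f _ => ?_
      rw [hword_append (ofFn_succ_ne_nil f), word_append, rstrips_append, smul_mul_assoc,
        mul_assoc, word_singleton]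
      rfl

end Derivative

/-! ### Border vectors and their words -/

section Border

/-- The word attached to an index of a block of the border vector. -/
def blockWord {k : ℕ} (i : BlockIdx g k) : List (Fin g) := i.2 :: List.ofFn i.1

theorem borderEntry_eq {k : ℕ} (i : BlockIdx g k) : borderEntry i = word (hword (blockWord i)) := by
  simp only [borderEntry, blockWord, hword, word_cons, hvar]
  simp only [word, List.map_ofFn]
  rfl

@[simp] theorem length_blockWord {k : ℕ} (i : BlockIdx g k) : (blockWord i).length = k + 1 := by
  simp [blockWord]

theorem blockWord_injective {k : ℕ} : Function.Injective (blockWord (g := g) (k := k)) := by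
  rintro ⟨m, i⟩ ⟨m', i'⟩ h
  simp only [blockWord, List.cons.injEq] at h
  rw [h.1, List.ofFn_injective h.2]

theorem exists_blockWord {k : ℕ} {b : List (Fin g)} (hb : b.length = k + 1) :
    ∃ i : BlockIdx g k, blockWord i = b := by
  cases b with
  | nil => simp at hb
  | cons j m =>
    obtain rfl : m.length = k := by simpa using hb
    exact ⟨(fun a => m.get a, j), by simp [blockWord]⟩

theorem sum_blockIdx {M : Type*} [AddCommMonoid M] (n : ℕ) (F : List (Fin g) → M) :
    ∑ i : BlockIdx g n, F (blockWord i) = ∑ f : Fin (n + 1) → Fin g, F (List.ofFn f) := by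
  rw [← (Fin.consEquiv fun _ => Fin g).sum_comp, Fintype.sum_prod_type, Fintype.sum_prod_type,
    Finset.sum_comm]
  refine Finset.sum_congr rfl fun k _ => Finset.sum_congr rfl fun f _ => ?_
  simp [Fin.consEquiv, blockWord]

/-- The word attached to an index of the border vector. -/
def lowWord {d : ℕ} (i : LowIdx g d) : List (Fin g) := blockWord i.2

/-- The word attached to an index of the extended border vector. -/
def fullWord {d : ℕ} : FullIdx g d → List (Fin g) := Sum.elim lowWord blockWord

variable {d : ℕ}

theorem border_eq (i : LowIdx g d) : border g d i = word (hword (lowWord i)) := borderEntry_eq _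

theorem borderExt_eq (i : FullIdx g d) : borderExt g d i = word (hword (fullWord i)) := by
  rcases i with i | i
  · exact borderEntry_eq _
  · exact borderEntry_eq _

theorem length_lowWord (i : LowIdx g d) : (lowWord i).length = i.1 + 1 := length_blockWord _

theorem lowWord_ne_nil (i : LowIdx g d) : lowWord i ≠ [] := List.cons_ne_nil _ _

theorem length_lowWord_lt (i : LowIdx g d) : (lowWord i).length < d := by
  have := i.1.2
  rw [length_lowWord]; omega

theorem fullWord_ne_nil (i : FullIdx g d) : fullWord i ≠ [] := by
  rcases i with i | i <;> exact List.cons_ne_nil _ _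

theorem lowWord_injective : Function.Injective (lowWord (g := g) (d := d)) := by
  rintro ⟨k, i⟩ ⟨k', i'⟩ h
  have hk := congrArg List.length h
  rw [length_lowWord, length_lowWord] at hk
  obtain rfl : k = k' := Fin.ext (by simpa using hk)
  exact congrArg _ (blockWord_injective h)

theorem fullWord_injective : Function.Injective (fullWord (g := g) (d := d)) := by
  have key : ∀ (i : LowIdx g d) (j : TopIdx g d), lowWord i ≠ blockWord j := fun i j h => by
    have h1 := length_lowWord_lt i
    rw [h, length_blockWord] at h1
    omega
  rintro (i | i) (j | j) h
  · exact congrArg _ (lowWord_injective h)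
  · exact absurd h (key i j)
  · exact absurd h.symm (key j i)
  · exact congrArg _ (blockWord_injective h)

theorem sum_lowIdx {M : Type*} [AddCommMonoid M] (F : List (Fin g) → M) :
    ∑ i : LowIdx g d, F (lowWord i) =
      ∑ m ∈ Finset.range (d - 1), ∑ f : Fin (m + 1) → Fin g, F (List.ofFn f) := by
  rw [Fintype.sum_sigma, Finset.sum_range]
  exact Finset.sum_congr rfl fun k _ => sum_blockIdx _ _

theorem sum_fullIdx {M : Type*} [AddCommMonoid M] (hd : 1 ≤ d) (F : List (Fin g) → M) :
    ∑ i : FullIdx g d, F (fullWord i) =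
      ∑ m ∈ Finset.range d, ∑ f : Fin (m + 1) → Fin g, F (List.ofFn f) := by
  obtain ⟨d, rfl⟩ := Nat.exists_eq_add_of_le' hd
  rw [Fintype.sum_sum_type, Finset.sum_range_succ]
  exact congrArg₂ (· + ·) (sum_lowIdx F) (sum_blockIdx _ F)

/-- The letter `h` stands only at the front of `hword`, so none of these words is a proper suffix of
another. The prefix `q` is therefore never reached. -/
theorem rstrips_hword_mul (b b' : List (Fin g)) (hb : b ≠ []) (hb' : b' ≠ []) (q : NCPolyXH g) :
    rstrips (hword b) (q * word (hword b')) = if b = b' then q else 0 := by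
  obtain ⟨j, m, rfl⟩ := List.exists_cons_of_ne_nil hb
  obtain ⟨j', m', rfl⟩ := List.exists_cons_of_ne_nil hb'
  clear hb hb'
  induction m using List.reverseRecOn generalizing m' with
  | nil =>
    rcases List.eq_nil_or_concat m' with rfl | ⟨u, x, rfl⟩
    · simp [hword, rstrips_cons, rstrip_mul_ι, eq_comm]
    · rw [List.concat_eq_append, ← List.cons_append, hword_append (List.cons_ne_nil _ _),
        word_append, ← mul_assoc]
      simp [hword, rstrips_cons, rstrip_mul_ι]
  | append_singleton m k ih =>
    rw [← List.cons_append, hword_append (List.cons_ne_nil _ _), rstrips_append]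
    rcases List.eq_nil_or_concat m' with rfl | ⟨u, x, rfl⟩
    · simp [hword, rstrips_cons, rstrip_mul_ι]
    · rw [List.concat_eq_append, show j' :: (u ++ [x]) = (j' :: u) ++ [x] from rfl,
        hword_append (List.cons_ne_nil _ _), word_append, ← mul_assoc, word_singleton, rstrips_cons, rstrips_nil, rstrip_mul_ι]
      by_cases hk : x = k
      · subst hk
        rw [if_pos rfl, ih]
        simp
      · have : k ≠ x := fun h => hk h.symm
        simp [hk, this]

end Border

/-! ### Uniqueness of coefficient vectors and middle matrices -/

section MiddleMatrix

variable {I : Type} [Fintype I] {v : I → NCPolyXH g} {e : I → List (Fin g)}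

theorem IsCoeffVector.inX_star_eq (hv : ∀ i, v i = word (hword (e i)))
    (he : Function.Injective e) (he' : ∀ i, e i ≠ []) {q : NCPolyXH g} {ψ : I → NCPoly g}
    (h : IsCoeffVector v q ψ) (i : I) : inX (star (ψ i)) = rstrips (hword (e i)) q := by
  classical
  rw [h, map_sum, Finset.sum_eq_single i]
  · rw [hv, rstrips_hword_mul _ _ (he' _) (he' _), if_pos rfl]
  · intro j _ hj
    rw [hv, rstrips_hword_mul _ _ (he' _) (he' _), if_neg fun h => hj (he h.symm)]
  · simp

theorem IsCoeffVector.unique (hv : ∀ i, v i = word (hword (e i)))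
    (he : Function.Injective e) (he' : ∀ i, e i ≠ []) {q : NCPolyXH g} {ψ φ : I → NCPoly g}
    (h : IsCoeffVector v q ψ) (h' : IsCoeffVector v q φ) : ψ = φ := by
  funext i
  apply star_injective
  apply inX_injective
  rw [h.inX_star_eq hv he he', h'.inX_star_eq hv he he']

/-- Stripping on the right isolates column `j`. The transpose of what is left is again a combination
of border entries, so a second stripping isolates the entry. -/
theorem IsMiddleMatrix.inX_eq (hv : ∀ i, v i = word (hword (e i)))
    (he : Function.Injective e) (he' : ∀ i, e i ≠ []) {q : NCPolyXH g}
    {M : Matrix I I (NCPoly g)} (h : IsMiddleMatrix v q M) (i j : I) :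
    inX (M i j) = star (rstrips (hword (e i)) (star (rstrips (hword (e j)) q))) := by
  classical
  have h1 : rstrips (hword (e j)) q = ∑ i, star (v i) * inX (M i j) := by
    rw [h, map_sum]
    refine Finset.sum_congr rfl fun i _ => ?_
    rw [map_sum, Finset.sum_eq_single j]
    · rw [hv j, rstrips_hword_mul _ _ (he' _) (he' _), if_pos rfl]
    · intro k _ hj
      rw [hv k, rstrips_hword_mul _ _ (he' _) (he' _), if_neg fun h => hj (he h.symm)]
    · simp
  have h2 : IsCoeffVector v (star (rstrips (hword (e j)) q)) fun i => M i j := by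
    rw [h1, IsCoeffVector, star_sum]
    simp [inX_star]
  rw [← h2.inX_star_eq hv he he', inX_star, star_star]

theorem IsMiddleMatrix.unique (hv : ∀ i, v i = word (hword (e i)))
    (he : Function.Injective e) (he' : ∀ i, e i ≠ []) {q : NCPolyXH g}
    {M N : Matrix I I (NCPoly g)} (h : IsMiddleMatrix v q M) (h' : IsMiddleMatrix v q N) :
    M = N := by
  ext i j
  apply inX_injective
  rw [h.inX_eq hv he he', h'.inX_eq hv he he']

end MiddleMatrix

/-! ### Explicit formulas for `ψ`, `Z` and `Z_λ` -/

section Formulas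

variable {d : ℕ} {p : NCPoly g}

/-- The coefficient vector of the first derivative. -/
def psiVec (d : ℕ) (p : NCPoly g) (i : FullIdx g d) : NCPoly g := star (rstrips (fullWord i) p)

/-- The entry of the middle matrix of the Hessian at a pair of words. -/
def midEntry (p : NCPoly g) (a b : List (Fin g)) : NCPoly g :=
  (2 : ℝ) • star (rstrips a (star (rstrips b p)))

/-- The middle matrix of the Hessian. -/
def midMatrix (d : ℕ) (p : NCPoly g) : Matrix (LowIdx g d) (LowIdx g d) (NCPoly g) :=
  Matrix.of fun i j => midEntry p (lowWord i) (lowWord j)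

theorem isCoeffVector_psiVec (hd : 1 ≤ d)
    (h : ∀ b : List (Fin g), d < b.length → wcoeff b p = 0) :
    IsCoeffVector (borderExt g d) (firstDeriv p) (psiVec d p) := by
  simp only [IsCoeffVector, borderExt_eq, psiVec, star_star]
  rw [sum_fullIdx hd fun b => inX (rstrips b p) * word (hword b), firstDeriv_eq_sum h]

theorem isMiddleMatrix_midMatrix (hd : 1 ≤ d)
    (h : ∀ b : List (Fin g), d < b.length → wcoeff b p = 0) :
    IsMiddleMatrix (border g d) (hessian p) (midMatrix d p) := by
  obtain ⟨n, rfl⟩ := Nat.exists_eq_add_of_le' hd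
  simp only [IsMiddleMatrix, border_eq, midMatrix, Matrix.of_apply]
  rw [Finset.sum_comm]
  rw [sum_lowIdx fun b => ∑ i : LowIdx g (n + 1),
    star (word (hword (lowWord i))) * inX (midEntry p (lowWord i) b) * word (hword b)]
  rw [hessian_eq_sum h, Finset.sum_range_succ]
  -- Removing a suffix of full length `d = n + 1` leaves a constant, whose derivative vanishes. This
  -- is why `V` stops at `V_{d-2}`.
  have htop : ∀ f : Fin (n + 1) → Fin g, firstDeriv (rstrips (List.ofFn f) p) = 0 := fun f => by
    rw [firstDeriv_eq_sum (n := 0)]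
    · simp
    · intro a ha
      rw [wcoeff_rstrips]
      exact h _ (by simp; omega)
  simp only [htop, zero_mul, smul_zero, Finset.sum_const_zero, add_zero, Nat.add_sub_cancel]
  refine Finset.sum_congr rfl fun m _ => Finset.sum_congr rfl fun f _ => ?_
  -- The remaining factor is expanded after transposition, so that its border entries come out
  -- starred on the left.
  have hlow : firstDeriv (star (rstrips (List.ofFn f) p)) = ∑ i : LowIdx g (n + 1),
      inX (rstrips (lowWord i) (star (rstrips (List.ofFn f) p))) * word (hword (lowWord i)) := by
    rw [sum_lowIdx fun a => inX (rstrips a (star (rstrips (List.ofFn f) p))) * word (hword a)]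
    refine firstDeriv_eq_sum fun a ha => ?_
    rw [wcoeff_star, wcoeff_rstrips]
    exact h _ (by simp at ha ⊢; omega)
  rw [firstDeriv_star, eq_comm, ← star_inj, star_star, star_sum] at hlow
  rw [← hlow, Finset.sum_mul, Finset.smul_sum]
  refine Finset.sum_congr rfl fun i _ => ?_
  simp [midEntry, inX_star, star_mul]

theorem isMiddleMatrix_modMiddle {Z : Matrix (LowIdx g d) (LowIdx g d) (NCPoly g)}
    {ψ : FullIdx g d → NCPoly g} (hZ : IsMiddleMatrix (border g d) (hessian p) Z)
    (hψ : IsCoeffVector (borderExt g d) (firstDeriv p) ψ) (lam : ℝ) :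
    IsMiddleMatrix (borderExt g d) (modifiedHessian p lam) (modMiddle Z ψ lam) := by
  have h1 : hessian p = ∑ i, ∑ j, star (borderExt g d i) *
      inX (Matrix.fromBlocks Z 0 0 (0 : Matrix (TopIdx g d) (TopIdx g d) (NCPoly g)) i j) *
        borderExt g d j := by
    simp only [Fintype.sum_sum_type, Matrix.fromBlocks_apply₁₁, Matrix.fromBlocks_apply₁₂,
      Matrix.fromBlocks_apply₂₁, Matrix.fromBlocks_apply₂₂, Matrix.zero_apply, map_zero, mul_zero,
      zero_mul, Finset.sum_const_zero, add_zero]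
    exact hZ
  have h2 : star (firstDeriv p) * firstDeriv p = ∑ i, ∑ j, star (borderExt g d i) *
      inX (ψ i * star (ψ j)) * borderExt g d j := by
    rw [hψ, star_sum, Finset.sum_mul_sum]
    simp [inX_star, mul_assoc]
  rw [IsMiddleMatrix, modifiedHessian, h2]
  conv_lhs => rw [h1]
  simp only [Finset.smul_sum, ← Finset.sum_add_distrib]
  refine Finset.sum_congr rfl fun i _ => Finset.sum_congr rfl fun j _ => ?_
  simp [modMiddle, mul_add, add_mul]

end Formulas

/-! ### Congruence by a square root of a unipotent element -/

section SquareRoot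

open Polynomial in
-- Newton correction: subtracting `r(0)/2 · X^(n+1)` from `f` cancels the lowest error term, because
-- `f(0) = 1`.
theorem exists_sqrt_one_sub_X (n : ℕ) :
    ∃ f r : ℝ[X], f.coeff 0 = 1 ∧ f ^ 2 = 1 - X + X ^ (n + 1) * r := by
  induction n with
  | zero => exact ⟨1, 1, by simp, by ring⟩
  | succ n ih =>
    obtain ⟨f, r, hf, h⟩ := ih
    obtain ⟨s, hs⟩ : X ∣ r - C (r.coeff 0) * f := by
      rw [X_dvd_iff]; simp [hf, mul_coeff_zero]
    refine ⟨f - C (r.coeff 0 / 2) * X ^ (n + 1), s + C (r.coeff 0 / 2) ^ 2 * X ^ n, ?_, ?_⟩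
    · simp [hf]
    · have h2 : C (r.coeff 0) = 2 * C (r.coeff 0 / 2) := by
        rw [← C_ofNat, ← C_mul]; congr 1; ring
      rw [h2] at hs
      have : r = X * s + 2 * C (r.coeff 0 / 2) * f := by rw [← hs]; ring
      linear_combination h + X ^ (n + 1) * this

variable {A : Type*} [Ring A] [StarRing A] [Algebra ℝ A] [StarModule ℝ A]

theorem mul_aeval_of_mul_eq_star_mul {z n : A} (h : z * n = star n * z) (f : Polynomial ℝ) :
    z * Polynomial.aeval n f = star (Polynomial.aeval n f) * z := by
  induction f using Polynomial.induction_on' with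
  | add p q hp hq => simp [mul_add, add_mul, hp, hq]
  | monomial k r =>
    have hk : z * n ^ k = star n ^ k * z := by
      induction k with
      | zero => simp
      | succ k ih => rw [pow_succ, ← mul_assoc, ih, mul_assoc, h, ← mul_assoc, ← pow_succ]
    simp [Polynomial.aeval_monomial, ← Algebra.smul_def, hk]

/-- With `u = f(n)` and `u² = 1 - n`, the relation `z u = star u * z` gives `star u * z * u = z u² =
c`. The element `s` is `u⁻¹`. -/
theorem exists_isUnit_star_mul_mul {z n c : A} (hz : star z = z) (hc : star c = c)
    (hn : IsNilpotent n) (h : z * (1 - n) = c) :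
    ∃ s : A, IsUnit s ∧ z = star s * c * s := by
  obtain ⟨k, hk⟩ := hn
  obtain ⟨f, r, -, hf⟩ := exists_sqrt_one_sub_X k
  have hf' := congrArg (Polynomial.aeval n) hf
  simp only [map_pow, map_add, map_sub, map_one, map_mul, Polynomial.aeval_X, pow_succ n, hk,
    zero_mul, add_zero] at hf'
  -- Both `z` and `z (1 - n)` are self-adjoint, hence so is `z n`.
  have h1 : z * n = star n * z := by
    have := congrArg star h
    rw [hc, ← h, star_mul, hz, star_sub, star_one, sub_mul, mul_sub, one_mul, mul_one] at this
    exact (sub_right_injective this).symm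
  have h2 := mul_aeval_of_mul_eq_star_mul h1 f
  have hu : IsUnit (Polynomial.aeval n f) := by
    have : IsUnit (Polynomial.aeval n f ^ 2) := by
      rw [hf']; exact IsNilpotent.isUnit_one_sub ⟨k, hk⟩
    exact (isUnit_pow_iff two_ne_zero).1 this
  obtain ⟨u, hu⟩ := hu
  refine ⟨↑u⁻¹, Units.isUnit _, ?_⟩
  have h3 : star (u : A) * z * u = c := by
    rw [hu, ← h2, mul_assoc, ← sq, hf', h]
  have h4 : star (↑u⁻¹ : A) * star (u : A) = 1 := by rw [← star_mul]; simp
  calc z = (star (↑u⁻¹ : A) * star (u : A)) * z * (u * ↑u⁻¹) := by simp [h4]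
    _ = _ := by rw [← h3]; simp only [mul_assoc]

end SquareRoot

instance {X : Type} : StarModule ℝ (FreeAlgebra ℝ X) where
  star_smul r p := by simpa using star_smul_real r p

variable {d : ℕ} {p : NCPoly g}

/-! ### The nilpotent shift and the polynomial congruence -/

section Nilpotent

theorem midEntry_star (hp : star p = p) (a b : List (Fin g)) :
    star (midEntry p a b) = midEntry p b a := by
  have := rstrips_star_rstrips_star a b p
  rw [hp] at this
  simp [midEntry, this]

theorem rstrip_midEntry (k : Fin g) (a b : List (Fin g)) :
    rstrip k (midEntry p a b) = midEntry p a (k :: b) := by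
  have := rstrip_star_rstrips_star k a (rstrips b p)
  rw [midEntry, map_smul, this, midEntry, rstrips_cons]

theorem constTerm_midEntry (a b : List (Fin g)) :
    constTerm (midEntry p a b) = 2 * wcoeff (a.reverse ++ b) p := by
  rw [midEntry, map_smul, constTerm_star, ← wcoeff, wcoeff_star, wcoeff_rstrips]; rfl

theorem midEntry_eq_zero (h : ∀ b : List (Fin g), d < b.length → wcoeff b p = 0)
    {a b : List (Fin g)} (hab : d < a.length + b.length) : midEntry p a b = 0 := by
  have : rstrips a (star (rstrips b p)) = 0 := by
    by_cases hb : d < b.length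
    · simp [rstrips_eq_zero h hb]
    refine rstrips_eq_zero (n := d - b.length) (fun u hu => ?_) (by omega)
    rw [wcoeff_star, wcoeff_rstrips]
    exact h _ (by simp; omega)
  simp [midEntry, this]

theorem exists_lowWord {b : List (Fin g)} (hb : b ≠ []) (hbd : b.length < d) :
    ∃ i : LowIdx g d, lowWord i = b := by
  have h1 : 0 < b.length := List.length_pos_iff.2 hb
  obtain ⟨i, hi⟩ := exists_blockWord (b := b) (k := b.length - 1) (by omega)
  exact ⟨⟨⟨b.length - 1, by omega⟩, i⟩, hi⟩

/-- The nilpotent matrix whose `(x_k w, w)` entries are `x_k`. -/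
def shiftMatrix (g d : ℕ) : Matrix (LowIdx g d) (LowIdx g d) (NCPoly g) :=
  Matrix.of fun a b => ∑ k, if lowWord a = k :: lowWord b then FreeAlgebra.ι ℝ k else 0

/-- Each factor lengthens the word by exactly one letter. -/
theorem shiftMatrix_pow_apply (k : ℕ) (a b : LowIdx g d)
    (h : (lowWord a).length ≠ (lowWord b).length + k) : (shiftMatrix g d ^ k) a b = 0 := by
  induction k generalizing b with
  | zero =>
    rw [pow_zero, Matrix.one_apply_ne]
    rintro rfl
    exact h rfl
  | succ k ih =>
    rw [pow_succ, Matrix.mul_apply]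
    refine Finset.sum_eq_zero fun c _ => ?_
    by_cases hc : (lowWord a).length = (lowWord c).length + k
    · have : shiftMatrix g d c b = 0 := by
        rw [shiftMatrix, Matrix.of_apply]
        refine Finset.sum_eq_zero fun x _ => if_neg fun hx => ?_
        rw [hx, List.length_cons] at hc
        omega
      rw [this, mul_zero]
    · rw [ih c hc, zero_mul]

theorem isNilpotent_shiftMatrix : IsNilpotent (shiftMatrix g d) := by
  refine ⟨d, ?_⟩
  ext1 a b
  have := length_lowWord_lt a
  exact shiftMatrix_pow_apply d a b (by omega)

/-- Sorting the words `w` in `Z_{a,b} = 2 ∑_w c_{aᵀwb} w` by their last letter gives `Z_{a,b} =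
𝒵_{a,b} + ∑_k Z_{a,kb} x_k`. -/
theorem midMatrix_mul_one_sub_shiftMatrix
    (h : ∀ b : List (Fin g), d < b.length → wcoeff b p = 0) :
    midMatrix d p * (1 - shiftMatrix g d) = constMatrix (scalarMiddle (midMatrix d p)) := by
  rw [mul_sub, mul_one, sub_eq_iff_eq_add]
  ext1 a b
  have h1 : midMatrix d p a b = _ :=
    eq_constTerm_add_sum_rstrip (midEntry p (lowWord a) (lowWord b))
  rw [h1, Matrix.add_apply, Matrix.mul_apply]
  congr 1
  simp only [shiftMatrix, Matrix.of_apply, Finset.mul_sum, rstrip_midEntry]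
  rw [Finset.sum_comm]
  refine Finset.sum_congr rfl fun k _ => ?_
  by_cases hb : (lowWord b).length + 1 < d
  · obtain ⟨i, hi⟩ := exists_lowWord (b := k :: lowWord b) (d := d) (by simp) (by simpa using hb)
    rw [Finset.sum_eq_single i]
    · rw [if_pos hi, ← hi]; rfl
    · intro j _ hj
      rw [if_neg fun hj' => hj (lowWord_injective (hj'.trans hi.symm)), mul_zero]
    · simp
  -- Here `b` has the maximal length `d - 1`, so `k b` is not an index. The entry at `(a, k b)`
  -- vanishes too: `a` is nonempty, so the total length exceeds `d`.
  · rw [midEntry_eq_zero h, zero_mul, Finset.sum_eq_zero]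
    · intro j _
      rw [if_neg, mul_zero]
      intro hj
      have := length_lowWord_lt j
      rw [hj, List.length_cons] at this
      exact hb this
    · have := List.length_pos_iff.2 (lowWord_ne_nil a)
      rw [List.length_cons]; omega

theorem midMatrix_conjTranspose (hp : star p = p) : (midMatrix d p)ᴴ = midMatrix d p := by
  ext1 a b
  exact midEntry_star hp _ _

theorem constMatrix_conjTranspose {I : Type} (A : Matrix I I ℝ) :
    (constMatrix A : Matrix I I (NCPoly g))ᴴ = constMatrix Aᵀ := by
  ext1 a b
  exact FreeAlgebra.star_algebraMap _

theorem scalarMiddle_midMatrix_isSymm (hp : star p = p) :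
    (scalarMiddle (midMatrix d p)).IsSymm := by
  ext a b
  have := constTerm_star (midEntry p (lowWord a) (lowWord b))
  rw [midEntry_star hp] at this
  exact this

theorem exists_congruence_midMatrix (hp : star p = p)
    (h : ∀ b : List (Fin g), d < b.length → wcoeff b p = 0) :
    ∃ S : Matrix (LowIdx g d) (LowIdx g d) (NCPoly g), IsUnit S ∧
      midMatrix d p = Sᴴ * constMatrix (scalarMiddle (midMatrix d p)) * S :=
  exists_isUnit_star_mul_mul (midMatrix_conjTranspose hp)
    ((constMatrix_conjTranspose _).trans (by rw [scalarMiddle_midMatrix_isSymm hp]))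
    isNilpotent_shiftMatrix (midMatrix_mul_one_sub_shiftMatrix h)

theorem isUnit_fromBlocks_zero_one {R m n : Type*} [Ring R] [Fintype m] [Fintype n]
    [DecidableEq m] [DecidableEq n] {A : Matrix m m R} (hA : IsUnit A) (C : Matrix n m R) :
    IsUnit (Matrix.fromBlocks A 0 C (1 : Matrix n n R)) := by
  obtain ⟨⟨A, B, hAB, hBA⟩, rfl⟩ := hA
  refine ⟨⟨Matrix.fromBlocks A 0 C 1, Matrix.fromBlocks B 0 (-(C * B)) 1, ?_, ?_⟩, rfl⟩
  · rw [Matrix.fromBlocks_multiply, ← Matrix.fromBlocks_one]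
    simp [hAB]
  · rw [Matrix.fromBlocks_multiply, ← Matrix.fromBlocks_one]
    simp [hBA, Matrix.mul_assoc]

/-- The top block `u` of `ψ` is constant and `λ u uᵀ` is independent of `x`. A lower-left block
sending `u` to the lower part `v` of `ψ` therefore produces all other blocks of `λ ψ ψᵀ` at once,
for every `λ`. -/
theorem exists_congruence_modMiddle {Z : Matrix (LowIdx g d) (LowIdx g d) (NCPoly g)}
    {ψ : FullIdx g d → NCPoly g} {A : Matrix (LowIdx g d) (LowIdx g d) (NCPoly g)}
    (hA : IsUnit A) (hZ : Z = Aᴴ * constMatrix (scalarMiddle Z) * A)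
    (hψ : ∀ i : TopIdx g d, ψ (Sum.inr i) = algebraMap ℝ (NCPoly g) (topVec ψ i))
    (hψ0 : topVec ψ ≠ 0) :
    ∃ S : Matrix (FullIdx g d) (FullIdx g d) (NCPoly g), IsUnit S ∧
      ∀ lam : ℝ, modMiddle Z ψ lam = Sᴴ * constMatrix (scalarModMiddle Z ψ lam) * S := by
  set t := topVec ψ with ht
  have htt : t ⬝ᵥ t ≠ 0 := fun h => hψ0 (dotProduct_self_eq_zero.1 h)
  let u : Matrix (TopIdx g d) Unit (NCPoly g) := Matrix.of fun i _ => algebraMap ℝ _ (t i)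
  -- Normalized so that `uᴴ w = 1`; then `u uᴴ (w vᴴ) = u vᴴ`.
  let w : Matrix (TopIdx g d) Unit (NCPoly g) := (t ⬝ᵥ t)⁻¹ • u
  let v : Matrix (LowIdx g d) Unit (NCPoly g) := Matrix.of fun i _ => ψ (Sum.inl i)
  have huu : uᴴ * u = (t ⬝ᵥ t) • 1 := by
    ext
    simp [u, Matrix.mul_apply, dotProduct, Algebra.smul_def]
  have huw : uᴴ * w = 1 := by
    simp only [w]
    rw [Matrix.mul_smul, huu, smul_smul, inv_mul_cancel₀ htt, one_smul]
  have hwu : wᴴ * u = 1 := by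
    rw [← Matrix.conjTranspose_inj, Matrix.conjTranspose_mul]
    simpa using huw
  refine ⟨Matrix.fromBlocks A 0 (w * vᴴ) 1, isUnit_fromBlocks_zero_one hA _, fun lam => ?_⟩
  have hconst : constMatrix (scalarModMiddle Z ψ lam) =
      Matrix.fromBlocks (constMatrix (scalarMiddle Z)) 0 0 (lam • (u * uᴴ)) := by
    rw [constMatrix, scalarModMiddle, Matrix.fromBlocks_map, ← ht]
    congr 1
    ext i j
    rw [Matrix.smul_apply, Matrix.mul_apply, Matrix.map_apply, Matrix.smul_apply,
      Matrix.vecMulVec_apply]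
    simp only [u, smul_eq_mul, map_mul, Matrix.of_apply, Matrix.conjTranspose_apply,
      FreeAlgebra.star_algebraMap, Finset.univ_unique, Finset.sum_singleton]
    exact (Algebra.smul_def _ _).symm
  have hmod : modMiddle Z ψ lam = Matrix.fromBlocks (Z + lam • (v * vᴴ)) (lam • (v * uᴴ))
      (lam • (u * vᴴ)) (lam • (u * uᴴ)) := by
    rw [modMiddle]
    ext (i | i) (j | j) <;> simp [u, v, Matrix.mul_apply, hψ]
  rw [hconst, hmod, Matrix.fromBlocks_conjTranspose, Matrix.fromBlocks_multiply,
    Matrix.fromBlocks_multiply]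
  simp only [Matrix.conjTranspose_mul, Matrix.conjTranspose_conjTranspose,
    Matrix.conjTranspose_zero, Matrix.conjTranspose_one, Matrix.mul_zero, Matrix.zero_mul,
    Matrix.mul_one, Matrix.one_mul, add_zero, zero_add, Matrix.mul_smul, Matrix.smul_mul]
  have e1 : v * wᴴ * (u * uᴴ) = v * uᴴ := by
    rw [Matrix.mul_assoc, ← Matrix.mul_assoc wᴴ, hwu, Matrix.one_mul]
  have e2 : u * uᴴ * (w * vᴴ) = u * vᴴ := by
    rw [Matrix.mul_assoc, ← Matrix.mul_assoc uᴴ, huw, Matrix.one_mul]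
  have e3 : v * uᴴ * (w * vᴴ) = v * vᴴ := by
    rw [Matrix.mul_assoc, ← Matrix.mul_assoc uᴴ, huw, Matrix.one_mul]
  rw [e1, e2, e3, ← hZ]

end Nilpotent

/-! ### Evaluation at tuples of symmetric matrices -/

section Evaluation

variable {I : Type} {n : ℕ}

theorem evalMatrix_mul [Fintype I] (X : Fin g → Matrix (Fin n) (Fin n) ℝ)
    (M N : Matrix I I (NCPoly g)) :
    evalMatrix X (M * N) = evalMatrix X M * evalMatrix X N := by
  ext ⟨i, a⟩ ⟨j, b⟩
  simp [evalMatrix, Matrix.mul_apply, Fintype.sum_prod_type, Matrix.sum_apply]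

theorem evalMatrix_constMatrix (X : Fin g → Matrix (Fin n) (Fin n) ℝ) (A : Matrix I I ℝ) :
    evalMatrix X (constMatrix A) = A ⊗ₖ (1 : Matrix (Fin n) (Fin n) ℝ) := by
  ext ⟨i, a⟩ ⟨j, b⟩
  simp [evalMatrix, constMatrix, Matrix.algebraMap_matrix_apply, Matrix.one_apply]

theorem evalMatrix_one [DecidableEq I] (X : Fin g → Matrix (Fin n) (Fin n) ℝ) :
    evalMatrix X (1 : Matrix I I (NCPoly g)) = 1 := by
  have : (1 : Matrix I I (NCPoly g)) = constMatrix 1 := by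
    ext1 i j; simp [constMatrix, Matrix.one_apply, apply_ite]
  rw [this, evalMatrix_constMatrix, Matrix.one_kronecker_one]

theorem lift_star {X : Fin g → Matrix (Fin n) (Fin n) ℝ} (hX : ∀ j, (X j).IsSymm) (p : NCPoly g) :
    FreeAlgebra.lift ℝ X (star p) = (FreeAlgebra.lift ℝ X p)ᵀ := by
  induction p using FreeAlgebra.induction with
  | grade0 r => simp [Matrix.algebraMap_eq_diagonal]
  | grade1 x => simp [(hX x).eq]
  | mul a b ha hb => simp [ha, hb]
  | add a b ha hb => simp [ha, hb]

theorem evalMatrix_conjTranspose {X : Fin g → Matrix (Fin n) (Fin n) ℝ} (hX : ∀ j, (X j).IsSymm)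
    (M : Matrix I I (NCPoly g)) : evalMatrix X Mᴴ = (evalMatrix X M)ᵀ := by
  ext ⟨i, a⟩ ⟨j, b⟩
  simp [evalMatrix, lift_star hX]

theorem det_evalMatrix_ne_zero [Fintype I] [DecidableEq I] (X : Fin g → Matrix (Fin n) (Fin n) ℝ)
    {S : Matrix I I (NCPoly g)} (hS : IsUnit S) : (evalMatrix X S).det ≠ 0 := by
  obtain ⟨T, hT⟩ := hS.exists_right_inv
  have := congrArg (evalMatrix X) hT
  rw [evalMatrix_mul, evalMatrix_one] at this
  exact (Matrix.isUnit_det_of_right_inverse this).ne_zero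

end Evaluation

/-! ### The top block of `ψ` is constant -/

section TopBlock

theorem psiVec_inr (h : ∀ b : List (Fin g), d < b.length → wcoeff b p = 0) (hd : 1 ≤ d)
    (i : TopIdx g d) : psiVec d p (Sum.inr i) = algebraMap ℝ _ (wcoeff (blockWord i) p) := by
  have h1 := eq_constTerm_add_sum_rstrip (rstrips (blockWord i) p)
  have h2 : ∀ k, rstrip k (rstrips (blockWord i) p) = 0 := fun k =>
    rstrips_eq_zero h (b := k :: blockWord i) (by simp; omega)
  simp only [h2, zero_mul, Finset.sum_const_zero, add_zero] at h1
  change star (rstrips (blockWord i) p) = _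
  rw [h1, FreeAlgebra.star_algebraMap]
  rfl

theorem topVec_psiVec (h : ∀ b : List (Fin g), d < b.length → wcoeff b p = 0) (hd : 1 ≤ d)
    (i : TopIdx g d) : topVec (psiVec d p) i = wcoeff (blockWord i) p := by
  rw [topVec, psiVec_inr h hd, AlgHom.commutes]; rfl

end TopBlock

/-! ### Eigenvalues after adding a rank one diagonal block -/

section Inertia

theorem posSemidef_fromBlocks_smul_vecMulVec_iff {m n : Type} [Fintype m] [Fintype n]
    (A : Matrix m m ℝ) {t : n → ℝ} {lam : ℝ} (hlam : 0 < lam) :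
    (Matrix.fromBlocks A 0 0 (lam • Matrix.vecMulVec t t)).PosSemidef ↔ A.PosSemidef := by
  refine ⟨fun h => h.submatrix Sum.inl, fun h => ?_⟩
  obtain ⟨k, v, rfl⟩ := Matrix.posSemidef_iff_eq_sum_vecMulVec.1 h
  have : Matrix.fromBlocks (∑ i, Matrix.vecMulVec (v i) (star (v i))) 0 0
      (lam • Matrix.vecMulVec t t) =
      ∑ i, Matrix.vecMulVec (Sum.elim (v i) (0 : n → ℝ)) (star (Sum.elim (v i) (0 : n → ℝ))) +
      lam • Matrix.vecMulVec (Sum.elim (0 : m → ℝ) t) (star (Sum.elim (0 : m → ℝ) t)) := by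
    ext (i | i) (j | j) <;> simp [Matrix.sum_apply, Matrix.vecMulVec_apply]
  rw [this]
  exact (Matrix.posSemidef_sum _ fun i _ => Matrix.posSemidef_vecMulVec_self_star _).add
    ((Matrix.posSemidef_vecMulVec_self_star _).smul hlam.le)

variable {m n : Type} [Fintype m] [Fintype n] [DecidableEq m] [DecidableEq n]

theorem roots_charpoly_smul_vecMulVec [Nonempty n] (lam : ℝ) (t : n → ℝ) :
    (lam • Matrix.vecMulVec t t).charpoly.roots =
      Multiset.replicate (Fintype.card n - 1) 0 + {lam * (t ⬝ᵥ t)} := by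
  have hn : Fintype.card n - 1 + 1 = Fintype.card n := Nat.sub_add_cancel Fintype.card_pos
  have h : (lam • Matrix.vecMulVec t t).charpoly =
      Polynomial.X ^ (Fintype.card n - 1) * (Polynomial.X - Polynomial.C (lam * (t ⬝ᵥ t))) := by
    rw [← Matrix.smul_vecMulVec, Matrix.charpoly_vecMulVec, smul_dotProduct, mul_sub, ← pow_succ,
      hn, Polynomial.smul_eq_C_mul, mul_comm (Polynomial.C _), smul_eq_mul]
  rw [h, Polynomial.roots_mul, Polynomial.roots_X_pow, Polynomial.roots_X_sub_C,
    Multiset.nsmul_singleton]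
  exact mul_ne_zero (pow_ne_zero _ Polynomial.X_ne_zero) (Polynomial.X_sub_C_ne_zero _)

theorem roots_charpoly_fromBlocks_diagonal (A : Matrix m m ℝ) (B : Matrix n n ℝ) :
    (Matrix.fromBlocks A 0 0 B).charpoly.roots = A.charpoly.roots + B.charpoly.roots := by
  rw [Matrix.charpoly_fromBlocks_zero₁₂, Polynomial.roots_mul]
  exact mul_ne_zero A.charpoly_monic.ne_zero B.charpoly_monic.ne_zero

variable (A : Matrix m m ℝ) {t : n → ℝ} {lam : ℝ}

theorem muPos_fromBlocks_smul_vecMulVec (ht : t ≠ 0) (hlam : 0 < lam) :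
    muPos (Matrix.fromBlocks A 0 0 (lam • Matrix.vecMulVec t t)) = muPos A + 1 := by
  obtain ⟨i, -⟩ := Function.ne_iff.1 ht
  have : Nonempty n := ⟨i⟩
  have hpos : 0 < lam * (t ⬝ᵥ t) :=
    mul_pos hlam (lt_of_le_of_ne (Finset.sum_nonneg fun i _ => mul_self_nonneg _)
      fun h => ht (dotProduct_self_eq_zero.1 h.symm))
  rw [muPos, roots_charpoly_fromBlocks_diagonal, roots_charpoly_smul_vecMulVec, muPos]
  have h0 : (Multiset.replicate (Fintype.card n - 1) (0 : ℝ)).filter (fun t => 0 < t) = 0 :=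
    Multiset.filter_eq_nil.2 fun a ha => by rw [Multiset.eq_of_mem_replicate ha]; simp
  simp [Multiset.filter_add, h0, Multiset.filter_singleton, hpos]

theorem muNeg_fromBlocks_smul_vecMulVec (ht : t ≠ 0) (hlam : 0 < lam) :
    muNeg (Matrix.fromBlocks A 0 0 (lam • Matrix.vecMulVec t t)) = muNeg A := by
  obtain ⟨i, -⟩ := Function.ne_iff.1 ht
  have : Nonempty n := ⟨i⟩
  have hpos : 0 ≤ lam * (t ⬝ᵥ t) :=
    mul_nonneg hlam.le (Finset.sum_nonneg fun i _ => mul_self_nonneg _)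
  rw [muNeg, roots_charpoly_fromBlocks_diagonal, roots_charpoly_smul_vecMulVec, muNeg]
  have h0 : (Multiset.replicate (Fintype.card n - 1) (0 : ℝ)).filter (fun t => t < 0) = 0 :=
    Multiset.filter_eq_nil.2 fun a ha => by rw [Multiset.eq_of_mem_replicate ha]; simp
  simp [Multiset.filter_add, h0, Multiset.filter_singleton, hpos.not_gt]

end Inertia

/-! ### Negative squares forced by triangular pairing -/

section Triangular

/-- A difference of squares with `b` negative squares that vanishes on the span of `r` vectors `x s`
and pairs triangularly with vectors `y s` forces `r ≤ b`. -/
theorem le_card_negative_squares {I K : Type*} [Fintype K] {b r : ℕ} {H : I → I → ℝ}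
    {α : K → I → ℝ} {β : Fin b → I → ℝ}
    (hH : ∀ i j, H i j = ∑ k, α k i * α k j - ∑ l, β l i * β l j) (x y : Fin r → I)
    (h0 : ∀ s t, H (x s) (x t) = 0) (h1 : ∀ s t, s < t → H (x t) (y s) = 0)
    (h2 : ∀ s, H (x s) (y s) ≠ 0) : r ≤ b := by
  by_contra! hbr
  -- With `r > b`, some nonzero combination `w` of the `x s` is killed by all negative forms `β l`.
  let L : (Fin r → ℝ) →ₗ[ℝ] (Fin b → ℝ) := Matrix.mulVecLin (Matrix.of fun l s => β l (x s))
  obtain ⟨w, hw, hw0⟩ := Submodule.exists_mem_ne_zero_of_ne_bot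
    (L.ker_ne_bot_of_finrank_lt (by simpa using hbr))
  have hβ : ∀ l, ∑ s, w s * β l (x s) = 0 := fun l => by
    have := congrFun (LinearMap.mem_ker.1 hw) l
    simpa [L, Matrix.mulVec, dotProduct, mul_comm] using this
  have expand : ∀ z, ∑ s, w s * H (x s) z = ∑ k, (∑ s, w s * α k (x s)) * α k z := fun z => by
    have hb : ∑ s, w s * ∑ l, β l (x s) * β l z = 0 := by
      simp_rw [Finset.mul_sum]
      rw [Finset.sum_comm]
      refine Finset.sum_eq_zero fun l _ => ?_
      simp_rw [← mul_assoc]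
      rw [← Finset.sum_mul, hβ, zero_mul]
    simp_rw [hH, mul_sub]
    rw [Finset.sum_sub_distrib, hb, sub_zero]
    simp_rw [Finset.mul_sum, Finset.sum_mul]
    rw [Finset.sum_comm]
    simp_rw [mul_assoc]
  -- On this combination `H` is a sum of squares of the `α k`; isotropy makes that sum zero, hence
  -- every term.
  have hα : ∀ k, ∑ s, w s * α k (x s) = 0 := by
    have : ∑ t, w t * ∑ s, w s * H (x s) (x t) = ∑ k, (∑ s, w s * α k (x s)) ^ 2 := by
      simp_rw [expand, Finset.mul_sum]
      rw [Finset.sum_comm]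
      refine Finset.sum_congr rfl fun k _ => ?_
      rw [sq, Finset.mul_sum]
      exact Finset.sum_congr rfl fun t _ => by ring
    simp only [h0, mul_zero, Finset.sum_const_zero] at this
    intro k
    exact pow_eq_zero_iff two_ne_zero |>.1
      ((Finset.sum_eq_zero_iff_of_nonneg fun _ _ => sq_nonneg _).1 this.symm k (Finset.mem_univ k))
  have hzero : ∀ z, ∑ s, w s * H (x s) z = 0 := fun z => by simp [expand, hα]
  have hex : ∃ s, w s ≠ 0 := Function.ne_iff.1 hw0
  -- At the least `s` with `w s ≠ 0`, pairing with `y s` leaves only the term `w s * H (x s) (y s)`: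
  -- smaller indices have zero weight and larger ones zero pairing.
  obtain ⟨s, hs, hmin⟩ := WellFounded.has_min (wellFounded_lt (α := Fin r)) {s | w s ≠ 0} hex
  have := hzero (y s)
  rw [Finset.sum_eq_single s] at this
  · exact mul_ne_zero hs (h2 s) this
  · intro t _ hts
    rcases lt_or_gt_of_ne hts with h | h
    · rw [not_not.1 fun h' => hmin t h' h, zero_mul]
    · rw [h1 s t h, mul_zero]
  · simp

theorem scalarMiddle_midMatrix_apply (i j : LowIdx g d) :
    scalarMiddle (midMatrix d p) i j = 2 * wcoeff ((lowWord i).reverse ++ lowWord j) p :=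
  constTerm_midEntry _ _

theorem degree_le_of_difference_of_squares {K : Type*} [Fintype K] {b : ℕ}
    (h : ∀ w : List (Fin g), d < w.length → wcoeff w p = 0)
    (hex : ∃ w : List (Fin g), w.length = d ∧ wcoeff w p ≠ 0)
    {α : K → LowIdx g d → ℝ} {β : Fin b → LowIdx g d → ℝ}
    (hH : ∀ i j, scalarMiddle (midMatrix d p) i j = ∑ k, α k i * α k j - ∑ l, β l i * β l j) :
    d ≤ 2 * b + 2 := by
  obtain ⟨w, hwd, hw⟩ := hex
  -- The cuts are placed after `d/2 + 1, …, d - 1` letters, so every prefix is longer than half of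
  -- `w` and every suffix is nonempty.
  have hx : ∀ s : Fin (d - 1 - d / 2), ∃ i : LowIdx g d,
      lowWord i = (w.take (d / 2 + 1 + s)).reverse := fun s => by
    have := s.2
    refine exists_lowWord (List.ne_nil_of_length_pos ?_) ?_ <;> simp <;> omega
  have hy : ∀ s : Fin (d - 1 - d / 2), ∃ i : LowIdx g d,
      lowWord i = w.drop (d / 2 + 1 + s) := fun s => by
    have := s.2
    refine exists_lowWord (List.ne_nil_of_length_pos ?_) ?_ <;> simp <;> omega
  choose x hx using hx
  choose y hy using hy
  -- Two prefixes, or a prefix with the suffix of an earlier cut, have more than `d` letters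
  -- together, so their entry vanishes. A prefix with its own suffix gives `2 c_w ≠ 0`.
  have : d - 1 - d / 2 ≤ b := by
    refine le_card_negative_squares hH x y (fun s t => ?_) (fun s t hst => ?_) fun s => ?_
    · have hs := s.2
      have ht := t.2
      rw [scalarMiddle_midMatrix_apply, h, mul_zero]
      rw [hx, hx]; simp; omega
    · have hs := s.2
      have ht := t.2
      have hst' : (s : ℕ) < t := hst
      rw [scalarMiddle_midMatrix_apply, h, mul_zero]
      rw [hx, hy]; simp; omega
    · rw [scalarMiddle_midMatrix_apply, hx, hy, List.reverse_reverse, List.take_append_drop]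
      simpa using hw
  omega

theorem degree_le_two_of_posSemidef
    (h : ∀ w : List (Fin g), d < w.length → wcoeff w p = 0)
    (hex : ∃ w : List (Fin g), w.length = d ∧ wcoeff w p ≠ 0)
    (hpos : (scalarMiddle (midMatrix d p)).PosSemidef) : d ≤ 2 := by
  obtain ⟨k, v, hv⟩ := Matrix.posSemidef_iff_eq_sum_vecMulVec.1 hpos
  have := degree_le_of_difference_of_squares (b := 0) (α := v) (β := Fin.elim0) h hex
    fun i j => by simp [hv, Matrix.sum_apply, Matrix.vecMulVec_apply]
  simpa using this

end Triangular

/-! ### From decompositions of `p''_λ` to decompositions of `𝒵` -/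

section SumsOfSquares

theorem mul_hvar_mem_linearInH (u v : NCPoly g) (j : Fin g) :
    inX u * hvar j * inX v ∈ linearInH g := Submodule.subset_span ⟨u, v, j, rfl⟩

theorem inX_mul_mem_linearInH (u : NCPoly g) {f : NCPolyXH g} (hf : f ∈ linearInH g) :
    inX u * f ∈ linearInH g := by
  induction hf using Submodule.span_induction with
  | mem f hf =>
    obtain ⟨u', v, j, rfl⟩ := hf
    simpa [mul_assoc] using mul_hvar_mem_linearInH (u * u') v j
  | zero => simp
  | add a b _ _ ha hb => rw [mul_add]; exact add_mem ha hb
  | smul r a _ ha => rw [mul_smul_comm]; exact Submodule.smul_mem _ _ ha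

theorem word_hword_mem_linearInH {b : List (Fin g)} (hb : b ≠ []) :
    word (hword b) ∈ linearInH g := by
  obtain ⟨j, m, rfl⟩ := List.exists_cons_of_ne_nil hb
  simpa [hword, word_cons, inX_word, hvar] using mul_hvar_mem_linearInH 1 (word m) j

theorem borderExt_mem_linearInH (i : FullIdx g d) : borderExt g d i ∈ linearInH g := by
  rw [borderExt_eq]; exact word_hword_mem_linearInH (fullWord_ne_nil i)

/-- Every word of `q` contains exactly one `h`, so the suffix `hword b`, which begins with an `h`,
lies within `q`. -/
theorem rstrips_hword_mul_of_mem {b : List (Fin g)} (hb : b ≠ []) (f : NCPolyXH g)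
    {q : NCPolyXH g} (hq : q ∈ linearInH g) :
    rstrips (hword b) (f * q) = f * rstrips (hword b) q := by
  induction hq using Submodule.span_induction with
  | mem q hq =>
    obtain ⟨u, v, j, rfl⟩ := hq
    induction v using word_induction with
    | hw w =>
      have : hvar j * inX (word w) = word (hword (j :: w)) := by
        simp [hword, word_cons, inX_word, hvar]
      rw [mul_assoc, this, ← mul_assoc, rstrips_hword_mul _ _ hb (List.cons_ne_nil _ _),
        rstrips_hword_mul _ _ hb (List.cons_ne_nil _ _)]
      split_ifs <;> simp
    | hadd a b ha hb => simp only [map_add, mul_add, ha, hb]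
    | hsmul r a ha => simp only [map_smul, mul_smul_comm, ha]
  | zero => simp
  | add a b _ _ ha hb => simp only [map_add, mul_add, ha, hb]
  | smul r a _ ha => simp only [map_smul, mul_smul_comm, ha]

/-- The coefficient of the product of the reversed `hword a` with `hword b`. -/
def pairCoeff (a b : List (Fin g)) (q : NCPolyXH g) : ℝ :=
  constTerm (rstrips (hword a) (star (rstrips (hword b) q)))

theorem pairCoeff_star_mul {a b : List (Fin g)} (ha : a ≠ []) (hb : b ≠ []) {f q : NCPolyXH g}
    (hf : f ∈ linearInH g) (hq : q ∈ linearInH g) :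
    pairCoeff a b (star f * q) = wcoeff (hword a) f * wcoeff (hword b) q := by
  rw [pairCoeff, rstrips_hword_mul_of_mem hb _ hq, star_mul, star_star,
    rstrips_hword_mul_of_mem ha _ hf, map_mul, constTerm_star, mul_comm]
  rfl

theorem constTerm_inX (q : NCPoly g) : constTerm (inX q) = constTerm q := by
  have : constTerm.comp inX = (constTerm : NCPoly g →ₐ[ℝ] ℝ) := by ext j; simp [inX, xvar]
  exact DFunLike.congr_fun this q

theorem IsMiddleMatrix.pairCoeff_eq {I : Type} [Fintype I] {v : I → NCPolyXH g}
    {e : I → List (Fin g)} (hv : ∀ i, v i = word (hword (e i)))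
    (he : Function.Injective e) (he' : ∀ i, e i ≠ []) {q : NCPolyXH g}
    {M : Matrix I I (NCPoly g)} (h : IsMiddleMatrix v q M) (i j : I) :
    pairCoeff (e i) (e j) q = atZero (M i j) := by
  rw [pairCoeff, ← constTerm_star, ← h.inX_eq hv he he', constTerm_inX]
  rfl

/-- Constant terms of the middle matrix write `Z_λ(0)` as a difference of `a` and `b` rank one
squares. Subtracting `c i` times row and column `t`, where `ψ_t(0) ≠ 0`, removes `λ ψ(0) ψ(0)ᵀ`. Row
`t` of the remaining part is zero, so exactly `𝒵` survives, with the same number of squares. -/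
theorem HasSDS.exists_scalarMiddle_eq {Z : Matrix (LowIdx g d) (LowIdx g d) (NCPoly g)}
    {ψ : FullIdx g d → NCPoly g} {q : NCPolyXH g} {lam : ℝ}
    (hM : IsMiddleMatrix (borderExt g d) q (modMiddle Z ψ lam)) (hψ : topVec ψ ≠ 0) {a b : ℕ}
    (h : HasSDS q a b) :
    ∃ (α : Fin a → LowIdx g d → ℝ) (β : Fin b → LowIdx g d → ℝ),
      ∀ i j, scalarMiddle Z i j = ∑ k, α k i * α k j - ∑ l, β l i * β l j := by
  obtain ⟨fp, fm, hfp, hfm, hq⟩ := h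
  obtain ⟨t, ht⟩ := Function.ne_iff.1 hψ
  let φ : FullIdx g d → ℝ := fun i => atZero (ψ i)
  have hφ : φ (Sum.inr t) ≠ 0 := ht
  let c : LowIdx g d → ℝ := fun i => φ (Sum.inl i) / φ (Sum.inr t)
  let A : NCPolyXH g → FullIdx g d → ℝ := fun f i => wcoeff (hword (fullWord i)) f
  have key : ∀ i j, atZero (modMiddle Z ψ lam i j) =
      ∑ k, A (fp k) i * A (fp k) j - ∑ l, A (fm l) i * A (fm l) j := fun i j => by
    rw [← hM.pairCoeff_eq borderExt_eq fullWord_injective fullWord_ne_nil, hq]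
    have hsq : ∀ f ∈ linearInH g, pairCoeff (fullWord i) (fullWord j) (star f * f) =
        A f i * A f j := fun f hf =>
      pairCoeff_star_mul (fullWord_ne_nil i) (fullWord_ne_nil j) hf hf
    simp_rw [← hsq _ (hfp _), ← hsq _ (hfm _)]
    simp only [pairCoeff, map_sub, star_sub, map_sum, star_sum]
  have hmod : ∀ i j, atZero (modMiddle Z ψ lam i j) =
      atZero (Matrix.fromBlocks Z 0 0 (0 : Matrix (TopIdx g d) (TopIdx g d) (NCPoly g)) i j) +
        lam * (φ i * φ j) := fun i j => by
    have : atZero (star (ψ j)) = φ j := constTerm_star (ψ j)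
    simp [modMiddle, φ, this]
  let B : NCPolyXH g → LowIdx g d → ℝ := fun f i => A f (Sum.inl i) - c i * A f (Sum.inr t)
  refine ⟨fun k => B (fp k), fun l => B (fm l), fun i j => ?_⟩
  have hc : ∀ i, φ (Sum.inl i) = c i * φ (Sum.inr t) := fun i => (div_mul_cancel₀ _ hφ).symm
  have hB : ∀ f, B f i * B f j = A f (Sum.inl i) * A f (Sum.inl j) -
      c j * (A f (Sum.inl i) * A f (Sum.inr t)) - c i * (A f (Sum.inr t) * A f (Sum.inl j)) +
      c i * c j * (A f (Sum.inr t) * A f (Sum.inr t)) := fun f => by simp only [B]; ring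
  simp_rw [hB, Finset.sum_add_distrib, Finset.sum_sub_distrib, ← Finset.mul_sum]
  have k1 := (hmod (Sum.inl i) (Sum.inl j)).symm.trans (key _ _)
  have k2 := (hmod (Sum.inl i) (Sum.inr t)).symm.trans (key _ _)
  have k3 := (hmod (Sum.inr t) (Sum.inl j)).symm.trans (key _ _)
  have k4 := (hmod (Sum.inr t) (Sum.inr t)).symm.trans (key _ _)
  simp only [Matrix.fromBlocks_apply₁₁, Matrix.fromBlocks_apply₁₂, Matrix.fromBlocks_apply₂₁,
    Matrix.fromBlocks_apply₂₂, Matrix.zero_apply, map_zero, hc] at k1 k2 k3 k4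
  change atZero (Z i j) = _
  -- These coefficients perform the simultaneous row and column elimination on the four relevant
  -- entries.
  linear_combination k1 - c j * k2 - c i * k3 + c i * c j * k4

/-- `q` is a difference of squares. -/
def IsDifferenceOfSquares (q : NCPolyXH g) : Prop := ∃ a b, HasSDS q a b

theorem IsDifferenceOfSquares.zero : IsDifferenceOfSquares (0 : NCPolyXH g) :=
  ⟨0, 0, Fin.elim0, Fin.elim0, fun j => j.elim0, fun j => j.elim0, by simp⟩

theorem IsDifferenceOfSquares.add {q r : NCPolyXH g} (hq : IsDifferenceOfSquares q)
    (hr : IsDifferenceOfSquares r) : IsDifferenceOfSquares (q + r) := by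
  obtain ⟨a, b, fp, fm, hfp, hfm, rfl⟩ := hq
  obtain ⟨a', b', fp', fm', hfp', hfm', rfl⟩ := hr
  refine ⟨a + a', b + b', Fin.append fp fp', Fin.append fm fm', ?_, ?_, ?_⟩
  · exact fun j => Fin.addCases (fun i => by simpa using hfp i) (fun i => by simpa using hfp' i) j
  · exact fun j => Fin.addCases (fun i => by simpa using hfm i) (fun i => by simpa using hfm' i) j
  · simp only [Fin.sum_univ_add, Fin.append_left, Fin.append_right]
    abel

theorem isDifferenceOfSquares_star_mul {f : NCPolyXH g} (hf : f ∈ linearInH g) :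
    IsDifferenceOfSquares (star f * f) :=
  ⟨1, 0, fun _ => f, Fin.elim0, fun _ => hf, fun j => j.elim0, by simp⟩

theorem isDifferenceOfSquares_neg_star_mul {f : NCPolyXH g} (hf : f ∈ linearInH g) :
    IsDifferenceOfSquares (-(star f * f)) :=
  ⟨0, 1, Fin.elim0, fun _ => f, fun j => j.elim0, fun _ => hf, by simp⟩

theorem isDifferenceOfSquares_polar {f r : NCPolyXH g} (hf : f ∈ linearInH g)
    (hr : r ∈ linearInH g) : IsDifferenceOfSquares (star f * r + star r * f) := by
  have : star f * r + star r * f =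
      star (f + r) * (f + r) + -(star f * f) + -(star r * r) := by
    rw [star_add]; noncomm_ring
  rw [this]
  exact ((isDifferenceOfSquares_star_mul (add_mem hf hr)).add
    (isDifferenceOfSquares_neg_star_mul hf)).add (isDifferenceOfSquares_neg_star_mul hr)

/-- Averaging `q` with its transpose writes it as a sum of polar terms `fᵀ r + rᵀ f`, each a
difference of squares by polarization. -/
theorem isDifferenceOfSquares_of_isMiddleMatrix {q : NCPolyXH g} (hq : star q = q)
    {M : Matrix (FullIdx g d) (FullIdx g d) (NCPoly g)}
    (hM : IsMiddleMatrix (borderExt g d) q M) : IsDifferenceOfSquares q := by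
  let f : FullIdx g d → NCPolyXH g := fun i => (2⁻¹ : ℝ) • borderExt g d i
  let r : FullIdx g d → FullIdx g d → NCPolyXH g := fun i j => inX (M i j) * borderExt g d j
  have hq' : q = ∑ i, ∑ j, (star (f i) * r i j + star (r i j) * f i) := by
    have h1 : (2⁻¹ : ℝ) • q = ∑ i, ∑ j, star (f i) * r i j := by
      conv_lhs => rw [hM]
      simp [Finset.smul_sum, f, r, mul_assoc]
    have h2 : (2⁻¹ : ℝ) • q = ∑ i, ∑ j, star (r i j) * f i := by
      have := congrArg star h1
      rw [star_smul_real, hq] at this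
      simpa using this
    simp_rw [Finset.sum_add_distrib]
    rw [← h1, ← h2, ← add_smul]
    norm_num
  rw [hq']
  refine Finset.sum_induction _ _ (fun _ _ => .add) .zero fun i _ =>
    Finset.sum_induction _ _ (fun _ _ => .add) .zero fun j _ => ?_
  exact isDifferenceOfSquares_polar (Submodule.smul_mem _ _ (borderExt_mem_linearInH i))
    (inX_mul_mem_linearInH _ (borderExt_mem_linearInH j))

theorem modifiedHessian_star (hp : star p = p) (lam : ℝ) :
    star (modifiedHessian p lam) = modifiedHessian p lam := by
  rw [modifiedHessian, star_add, ← hessian_star, hp, star_smul_real, star_mul, star_star]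

end SumsOfSquares

end NCHess

end

/-! ### The main theorem -/

open NCHess in
theorem theorem1p9 (g d : ℕ) (hd : 1 ≤ d) (p : NCPoly g) (hp : star p = p)
    (hdeg : ncDegree p = d) :
    (∃! Z : Matrix (LowIdx g d) (LowIdx g d) (NCPoly g),
      IsMiddleMatrix (border g d) (hessian p) Z) ∧
    (∃! ψ : FullIdx g d → NCPoly g, IsCoeffVector (borderExt g d) (firstDeriv p) ψ) ∧
    ∀ (Z : Matrix (LowIdx g d) (LowIdx g d) (NCPoly g)) (ψ : FullIdx g d → NCPoly g),
      IsMiddleMatrix (border g d) (hessian p) Z →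
      IsCoeffVector (borderExt g d) (firstDeriv p) ψ →
      (∀ (lam : ℝ) (M : Matrix (FullIdx g d) (FullIdx g d) (NCPoly g)),
        IsMiddleMatrix (borderExt g d) (modifiedHessian p lam) M ↔ M = modMiddle Z ψ lam) ∧
      (scalarMiddle Z).IsSymm ∧
      (∀ i : TopIdx g d, ψ (Sum.inr i) = algebraMap ℝ (NCPoly g) (topVec ψ i)) ∧
      topVec ψ ≠ 0 ∧
      (∃ S : Matrix (FullIdx g d) (FullIdx g d) (NCPoly g), IsUnit S ∧
        (∀ lam : ℝ, modMiddle Z ψ lam = Sᴴ * constMatrix (scalarModMiddle Z ψ lam) * S) ∧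
        ∀ (n : ℕ) (X : Fin g → Matrix (Fin n) (Fin n) ℝ), (∀ j, (X j).IsSymm) →
          (evalMatrix X S).det ≠ 0 ∧
          ∀ lam : ℝ, evalMatrix X (modMiddle Z ψ lam) =
            (evalMatrix X S)ᵀ * (scalarModMiddle Z ψ lam ⊗ₖ (1 : Matrix (Fin n) (Fin n) ℝ)) *
              evalMatrix X S) ∧
      ∀ lam : ℝ, 0 < lam →
        (muPos (scalarModMiddle Z ψ lam) = muPos (scalarMiddle Z) + 1 ∧
          muNeg (scalarModMiddle Z ψ lam) = muNeg (scalarMiddle Z)) ∧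
        ((scalarModMiddle Z ψ lam).PosSemidef ↔ (scalarMiddle Z).PosSemidef) ∧
        ((scalarModMiddle Z ψ lam).PosSemidef → d ≤ 2) ∧
        d ≤ 2 * sigmaNegMin (modifiedHessian p lam) + 2 := by
  have h : ∀ b : List (Fin g), d < b.length → wcoeff b p = 0 := fun b hb =>
    wcoeff_eq_zero_of_ncDegree_lt (hdeg ▸ hb)
  have hex : ∃ b : List (Fin g), b.length = d ∧ wcoeff b p ≠ 0 := by
    obtain ⟨b, hb, hb'⟩ := exists_wcoeff_ne_zero (p := p) (hdeg ▸ hd)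
    exact ⟨b, hb.trans hdeg, hb'⟩
  have hZ₀ := isMiddleMatrix_midMatrix hd h
  have hψ₀ := isCoeffVector_psiVec hd h
  have hZu : ∀ Z, IsMiddleMatrix (border g d) (hessian p) Z → Z = midMatrix d p := fun Z hZ =>
    hZ.unique border_eq lowWord_injective lowWord_ne_nil hZ₀
  have hψu : ∀ ψ, IsCoeffVector (borderExt g d) (firstDeriv p) ψ → ψ = psiVec d p := fun ψ hψ =>
    hψ.unique borderExt_eq fullWord_injective fullWord_ne_nil hψ₀
  refine ⟨⟨_, hZ₀, hZu⟩, ⟨_, hψ₀, hψu⟩, fun Z ψ hZ hψ => ?_⟩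
  obtain rfl := hZu Z hZ
  obtain rfl := hψu ψ hψ
  have hmod := isMiddleMatrix_modMiddle hZ hψ
  have hconst : ∀ i : TopIdx g d,
      psiVec d p (Sum.inr i) = algebraMap ℝ (NCPoly g) (topVec (psiVec d p) i) := fun i => by
    rw [topVec_psiVec h hd, psiVec_inr h hd]
  have htop : topVec (psiVec d p) ≠ 0 := by
    obtain ⟨b, hb, hb'⟩ := hex
    obtain ⟨i, rfl⟩ := exists_blockWord (b := b) (k := d - 1) (by omega)
    exact fun h0 => hb' (by rw [← topVec_psiVec h hd, h0]; rfl)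
  obtain ⟨A, hA, hZA⟩ := exists_congruence_midMatrix hp h
  obtain ⟨S, hS, hcong⟩ := exists_congruence_modMiddle hA hZA hconst htop
  refine ⟨fun lam M => ⟨fun hM =>
      hM.unique borderExt_eq fullWord_injective fullWord_ne_nil (hmod lam),
      fun hM => hM ▸ hmod lam⟩,
    scalarMiddle_midMatrix_isSymm hp, hconst, htop,
    ⟨S, hS, hcong, fun n X hX => ⟨by convert det_evalMatrix_ne_zero X hS, fun lam => ?_⟩⟩,
    fun lam hlam => ?_⟩
  · rw [hcong, evalMatrix_mul, evalMatrix_mul, evalMatrix_conjTranspose hX,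
      evalMatrix_constMatrix]
  have hpos := posSemidef_fromBlocks_smul_vecMulVec_iff (scalarMiddle (midMatrix d p))
    (t := topVec (psiVec d p)) hlam
  refine ⟨⟨muPos_fromBlocks_smul_vecMulVec _ htop hlam,
      muNeg_fromBlocks_smul_vecMulVec _ htop hlam⟩,
    hpos, fun h' => degree_le_two_of_posSemidef h hex (hpos.1 h'), ?_⟩
  -- The infimum of the empty set is `0` by convention; nonemptiness ensures that `sigmaNegMin` is
  -- attained by an actual decomposition.
  have hne : {b | ∃ a, HasSDS (modifiedHessian p lam) a b}.Nonempty := by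
    obtain ⟨a, b, hab⟩ := isDifferenceOfSquares_of_isMiddleMatrix
      (modifiedHessian_star hp lam) (hmod lam)
    exact ⟨b, a, hab⟩
  obtain ⟨a, hab⟩ := Nat.sInf_mem hne
  obtain ⟨α, β, hαβ⟩ := hab.exists_scalarMiddle_eq (hmod lam) htop
  exact degree_le_of_difference_of_squares h hex hαβ
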